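/- **Setting.** Let $\mathcal H$ be a separable Hilbert space and $\mathcal A:D(\mathcal A)\subset\mathcal H\to\mathcal H$ a densely defined, closed, self-adjoint, positive definite operator with pure point spectrum $0<\lambda_0\le\lambda_1\le\cdots$, $\lambda_n\to\infty$, and a complete orthonormal system of eigenvectors $\mathcal A\psi_j=\lambda_j\psi_j$ $(j\ge 0)$. Let $(\mathfrak T(t))_{t\ge0}$ be the semigroup generated by $-\mathcal A$. Fix $\alpha\in(0,1)$, let $\mathcal H_\alpha=D(\mathcal A^\alpha)$ with $\|x\|_\alpha=\|\mathcal A^\alpha x\|$, and let $M,M_\alpha>0$ satisfy $\|\mathfrak T(t)\|\le M$ $(t\ge0)$ and $\|\mathcal A^\alpha\mathfrak T(t)\|\le M_\alpha t^{-\alpha}$ $(t>0)$. Let $P^n$ be the orthogonal projection onto $\mathrm{span}\{\psi_0,\dots,\psi_n\}$. Let $\tau>0$, $q\ge1$ and $0=\varsigma_0=\varrho_0<\varrho_1<\varsigma_1<\varrho_2<\cdots<\varsigma_q<\varrho_{q+1}=T$. Let $PC_0^\alpha$ be the space of functions $[-\tau,0]\to\mathcal H_\alpha$ that are left continuous, have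 right limits, and have finitely many discontinuities, with norm $\|x\|_{0,\alpha}=\sup_{[-\tau,0]}\|x(\theta)\|_\alpha$. Let $PC_T^\alpha$ be the space of functions $y:[-\tau,T]\to\mathcal H_\alpha$ with $y|_{[-\tau,0]}\in PC_0^\alpha$ that are continuous on each $(\varrho_i,\varrho_{i+1}]$ and have a right limit at each $\varrho_i$ $(0\le i\le q)$, with norm $\|y\|_{T,\alpha}=\sup_{[-\tau,T]}\|y(t)\|_\alpha$. For $s\in[0,T]$ write $y_s(\theta)=y(s+\theta)$, $\theta\in[-\tau,0]$. **Hypotheses.** Let $\chi\in PC_0^\alpha$ be locally Hölder continuous into $\mathcal H$, with $\chi(t)\in D(\mathcal A)$ for all $t\in[-\tau,0]$. Let $\bar\chi=\chi$ on $[-\tau,0]$ and $\bar\chi=\chi(0)$ on $[0,T]$, and write $c=\|\bar\chi\|_{T,\alpha}$. Let $\mathfrak F:[0,T]\times PC_0^\alpha\to\mathcal H$ be continuous, with $s\mapsto\mathfrak F(s,y_s)$ strongly measurable on $[0,T]$ for every $y\in PC_T^\alpha$. Let $h_i:(\varrho_i,\varsigma_i]\times\mathcal H_\alpha\to\mathcal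 H_\alpha$ $(1\le i\le q)$ be continuous. Let $\eta\in(0,1]$ and let $L_{\mathfrak F},L_{h_i},M_h$ be positive constants. Put $B_1=\|\mathfrak F(0,0)\|$, $$Q_i=M_\alpha L_{\mathfrak F}\frac{\varrho_{i+1}^{1-\alpha}}{1-\alpha},\qquad N_i=d_i+M_\alpha\big[L_{\mathfrak F}(T^\eta+c)+B_1\big]\frac{\varrho_{i+1}^{1-\alpha}}{1-\alpha}\qquad(0\le i\le q),$$ where $d_0=\sup_{t\in[0,T]}\|(\mathfrak T(t)-I)\chi(0)\|_\alpha$ and $d_i=MM_h+c$ for $i\ge1$. Assume $Q_i<1$ for $0\le i\le q$ and put $$R=\max\Big(\max_{0\le i\le q}\frac{N_i}{1-Q_i},\;M_h+c\Big).$$ Assume that for all $s,t\in[0,T]$ and $x,z\in PC_0^\alpha$ with $\|x-\bar\chi_s\|_{0,\alpha}\le R$ and $\|z-\bar\chi_t\|_{0,\alpha}\le R$, $$\|\mathfrak F(s,x)-\mathfrak F(t,z)\|\le L_{\mathfrak F}\big(|s-t|^\eta+\|x-z\|_{0,\alpha}\big).$$ Assume also that for $1\le i\le q$ and $s,t\in(\varrho_i,\varsigma_i]$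 we have $\|h_i(t,x)\|_\alpha\le M_h$ for all $x\in\mathcal H_\alpha$, and $$\|h_i(s,x)-h_i(t,z)\|_\alpha\le L_{h_i}\big(|s-t|+\|x-z\|_\alpha\big)$$ whenever $\|x-\bar\chi(s)\|_\alpha\le R$ and $\|z-\bar\chi(t)\|_\alpha\le R$. **Conclusion.** There is a unique $y\in PC_T^\alpha$ satisfying $$y(t)=\begin{cases}\chi(t),&t\in[-\tau,0],\\ \mathfrak T(t)\chi(0)+\int_0^t\mathfrak T(t-s)\mathfrak F(s,y_s)\,ds,&t\in[0,\varrho_1],\\ h_i(t,y(\varrho_i^-)),&t\in(\varrho_i,\varsigma_i],\ 1\le i\le q,\\ \mathfrak T(t-\varsigma_i)h_i(\varsigma_i,y(\varrho_i^-))+\int_{\varsigma_i}^t\mathfrak T(t-s)\mathfrak F(s,y_s)\,ds,&t\in(\varsigma_i,\varrho_{i+1}],\ 1\le i\le q\end{cases}$$ (all integrals existing). For every $n\ge0$ there is a unique $y_n\in PC_T^\alpha$ satisfying the same system with $\mathfrak F$ and $h_i$ replaced by $\mathfrak F_n(s,x)=\mathfrak F(s,P^nx)$ and $h_{i,n}(t,x)=h_i(t,P^nx)$.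 Moreover $\|y_n-y\|_{T,\alpha}\to0$ as $n\to\infty$. -/

import Mathlib

open Set Filter Topology MeasureTheory

noncomputable section

namespace ImpulsiveRetarded

/-- A densely defined, closed, self-adjoint, positive definite operator `A` on a Hilbert space `H`
with pure point spectrum `0 < lam 0 ≤ lam 1 ≤ ...`, `lam n → ∞`, and a complete orthonormal system
`ψ` of eigenvectors, `A (ψ j) = lam j • ψ j`. -/
structure SpectralOperator (𝕜 : Type*) (H : Type*) [RCLike 𝕜] [NormedAddCommGroup H]
    [InnerProductSpace 𝕜 H] [CompleteSpace H] where
  A : H →ₗ.[𝕜] H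
  dense_domain : Dense (A.domain : Set H)
  closed : A.IsClosed
  selfAdjoint : IsSelfAdjoint A
  posDef : ∀ x : A.domain, x ≠ 0 → 0 < RCLike.re (inner 𝕜 (A x) (x : H))
  lam : ℕ → ℝ
  lam_pos : 0 < lam 0
  lam_mono : Monotone lam
  lam_tendsto : Tendsto lam atTop atTop
  ψ : HilbertBasis ℕ 𝕜 H
  ψ_mem : ∀ j, ψ j ∈ A.domain
  eigen : ∀ j, A ⟨ψ j, ψ_mem j⟩ = (lam j : 𝕜) • ψ j

/-- `T` (restricted to `t ≥ 0`) is the strongly continuous semigroup of bounded operators whose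
infinitesimal generator is `-A` (with exactly the domain of `A`). -/
structure IsSemigroupGeneratedByNeg {𝕜 H : Type*} [RCLike 𝕜] [NormedAddCommGroup H]
    [InnerProductSpace 𝕜 H] (A : H →ₗ.[𝕜] H) (T : ℝ → H →L[𝕜] H) : Prop where
  map_zero : T 0 = ContinuousLinearMap.id 𝕜 H
  map_add : ∀ s t : ℝ, 0 ≤ s → 0 ≤ t → T (s + t) = (T s).comp (T t)
  strong_continuity : ∀ x : H, Tendsto (fun t => T t x) (𝓝[>] 0) (𝓝 x)
  generator : ∀ x y : H, (∃ hx : x ∈ A.domain, y = -A ⟨x, hx⟩) ↔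
    Tendsto (fun t : ℝ => ((t : 𝕜)⁻¹) • (T t x - x)) (𝓝[>] 0) (𝓝 y)

namespace SpectralOperator

variable {𝕜 H : Type*} [RCLike 𝕜] [NormedAddCommGroup H] [InnerProductSpace 𝕜 H] [CompleteSpace H]

theorem lam_pos' (S : SpectralOperator 𝕜 H) (j : ℕ) : 0 < S.lam j :=
  S.lam_pos.trans_le (S.lam_mono (Nat.zero_le j))

/-- The domain of the fractional power `A ^ α`: all `x = ∑ xⱼ ψⱼ` with
`∑ (lam j ^ α * |xⱼ|) ^ 2 < ∞`. -/
def fracDomain (S : SpectralOperator 𝕜 H) (α : ℝ) : Submodule 𝕜 H where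
  carrier := {x | Memℓp (fun j => ((S.lam j ^ α : ℝ) : 𝕜) * S.ψ.repr x j) 2}
  zero_mem' := by
    have h : (fun j => ((S.lam j ^ α : ℝ) : 𝕜) * S.ψ.repr (0 : H) j) = 0 := by
      funext j; simp
    simp only [mem_ofPred_eq, h]
    exact zero_memℓp
  add_mem' := by
    intro x y hx hy
    have h := Memℓp.add hx hy
    have e : (fun j => ((S.lam j ^ α : ℝ) : 𝕜) * S.ψ.repr (x + y) j) =
        (fun j => ((S.lam j ^ α : ℝ) : 𝕜) * S.ψ.repr x j) +
        (fun j => ((S.lam j ^ α : ℝ) : 𝕜) * S.ψ.repr y j) := by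
      funext j; simp [mul_add]
    simp only [mem_ofPred_eq, e]
    exact h
  smul_mem' := by
    intro c x hx
    have h := Memℓp.const_smul hx c
    have e : (fun j => ((S.lam j ^ α : ℝ) : 𝕜) * S.ψ.repr (c • x) j) =
        c • (fun j => ((S.lam j ^ α : ℝ) : 𝕜) * S.ψ.repr x j) := by
      funext j; simp [mul_left_comm]
    simp only [mem_ofPred_eq, e]
    exact h

/-- The fractional power `A ^ α`, `A ^ α (∑ xⱼ ψⱼ) = ∑ lam j ^ α * xⱼ ψⱼ`, as an unbounded
operator. -/
def fracPow (S : SpectralOperator 𝕜 H) (α : ℝ) : H →ₗ.[𝕜] H where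
  domain := S.fracDomain α
  toFun :=
    { toFun := fun x => S.ψ.repr.symm
        (⟨fun j => ((S.lam j ^ α : ℝ) : 𝕜) * S.ψ.repr (x : H) j, x.2⟩ : lp (fun _ : ℕ => 𝕜) 2)
      map_add' := by
        intro x y
        rw [← map_add]
        congr 1
        ext j
        change _ = ((S.lam j ^ α : ℝ) : 𝕜) * S.ψ.repr (x : H) j +
          ((S.lam j ^ α : ℝ) : 𝕜) * S.ψ.repr (y : H) j
        simp [mul_add]
      map_smul' := by
        intro c x
        rw [RingHom.id_apply, ← map_smul]
        congr 1
        ext j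
        simp [mul_left_comm] }

/-- The space `H_α = D(A ^ α)`, to be normed by `‖x‖_α = ‖A ^ α x‖`. -/
def FracSpace (S : SpectralOperator 𝕜 H) (α : ℝ) : Type _ := (S.fracPow α).domain

namespace FracSpace

variable {S : SpectralOperator 𝕜 H} {α : ℝ}

instance : AddCommGroup (S.FracSpace α) := inferInstanceAs (AddCommGroup (S.fracPow α).domain)
instance : Module 𝕜 (S.FracSpace α) := inferInstanceAs (Module 𝕜 (S.fracPow α).domain)

/-- The inclusion of `H_α` in `H`. -/
def incl : S.FracSpace α →ₗ[𝕜] H := (S.fracPow α).domain.subtype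

instance : CoeOut (S.FracSpace α) H := ⟨fun x => incl x⟩

/-- `A ^ α` as an everywhere defined linear map on `H_α`. -/
def pow : S.FracSpace α →ₗ[𝕜] H := (S.fracPow α).toFun

theorem repr_pow (x : S.FracSpace α) (j : ℕ) :
    S.ψ.repr (pow x) j = ((S.lam j ^ α : ℝ) : 𝕜) * S.ψ.repr (incl x) j := by
  change S.ψ.repr (S.ψ.repr.symm _) j = _
  rw [LinearIsometryEquiv.apply_symm_apply]
  rfl

theorem pow_injective : Function.Injective (pow : S.FracSpace α →ₗ[𝕜] H) := by
  intro x y hxy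
  have h : incl x = incl y := by
    apply S.ψ.repr.injective
    ext j
    have h1 : S.ψ.repr (pow x) j = S.ψ.repr (pow y) j := by rw [hxy]
    rw [repr_pow, repr_pow] at h1
    have h2 : ((S.lam j ^ α : ℝ) : 𝕜) ≠ 0 := by
      exact_mod_cast (Real.rpow_pos_of_pos (S.lam_pos' j) α).ne'
    exact mul_left_cancel₀ h2 h1
  exact Subtype.ext h

/-- The norm `‖x‖_α = ‖A ^ α x‖`. -/
instance : NormedAddCommGroup (S.FracSpace α) :=
  NormedAddCommGroup.induced _ _ (pow : S.FracSpace α →ₗ[𝕜] H) pow_injective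

instance : NormedSpace 𝕜 (S.FracSpace α) :=
  NormedSpace.induced 𝕜 (S.FracSpace α) H (pow : S.FracSpace α →ₗ[𝕜] H)

end FracSpace

theorem ψ_mem_fracDomain (S : SpectralOperator 𝕜 H) (α : ℝ) (j : ℕ) : S.ψ j ∈ S.fracDomain α := by
  have e : (fun k => ((S.lam k ^ α : ℝ) : 𝕜) * S.ψ.repr (S.ψ j) k) =
      ((((S.lam j ^ α : ℝ) : 𝕜)) • (lp.single 2 j (1 : 𝕜) : lp (fun _ : ℕ => 𝕜) 2) : ℕ → 𝕜) := by
    funext k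
    rw [HilbertBasis.repr_self]
    by_cases hk : k = j
    · subst hk; simp
    · simp [hk]
  change Memℓp (fun k => ((S.lam k ^ α : ℝ) : 𝕜) * S.ψ.repr (S.ψ j) k) 2
  rw [e]
  exact Memℓp.const_smul (lp.memℓp _) _

/-- The orthogonal projection `Pⁿ x = ∑_{j ≤ n} ⟨ψⱼ, x⟩ ψⱼ` onto `span {ψ₀, ..., ψₙ}`, acting on
`H_α`. -/
def proj (S : SpectralOperator 𝕜 H) {α : ℝ} (n : ℕ) (x : S.FracSpace α) : S.FracSpace α :=
  ⟨∑ j ∈ Finset.range (n + 1), inner 𝕜 (S.ψ j) (x : H) • S.ψ j,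
    Submodule.sum_mem _ fun j _ => Submodule.smul_mem _ _ (S.ψ_mem_fracDomain α j)⟩

open Classical in
/-- `‖x‖_α = ‖A ^ α x‖` for an element `x` of `H` lying in `D(A ^ α)` (and `0` for other `x`). -/
def fracNorm (S : SpectralOperator 𝕜 H) (α : ℝ) (x : H) : ℝ :=
  if hx : x ∈ (S.fracPow α).domain then ‖S.fracPow α ⟨x, hx⟩‖ else 0

end SpectralOperator

/-! ### Piecewise continuous functions -/

section PiecewiseContinuous

variable {E : Type*} [NormedAddCommGroup E]

/-- The supremum norm. -/
def supNorm {ι : Type*} (x : ι → E) : ℝ := ⨆ t, ‖x t‖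

/-- The history space `PC([-τ, 0]; E)`: left continuous functions with right limits and finitely
many discontinuities. -/
def IsPCHistory (τ : ℝ) (x : Icc (-τ) 0 → E) : Prop :=
  (∀ θ, ContinuousWithinAt x (Iic θ) θ) ∧
  (∀ θ, ∃ l, Tendsto x (𝓝[>] θ) (𝓝 l)) ∧
  {θ | ¬ ContinuousAt x θ}.Finite

/-- The history `y_s(θ) = y(s + θ)`, `-τ ≤ θ ≤ 0`. -/
def hist (τ : ℝ) (y : ℝ → E) (s : ℝ) : Icc (-τ) 0 → E := fun θ => y (s + θ)

/-- The space `PC([-τ, T]; E)`, where `T = ρ (q + 1)`: functions that are in `PC([-τ, 0]; E)`,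
are continuous on each `(ρ i, ρ (i + 1)]` (so that `y(ρ i ⁻) = y(ρ i)` for `i ≥ 1`), and have a
right limit at each `ρ i`. Only the values on `[-τ, T]` matter. -/
def IsPC (τ : ℝ) (ρ : ℕ → ℝ) (q : ℕ) (y : ℝ → E) : Prop :=
  IsPCHistory τ (fun θ => y θ) ∧
  (∀ i ≤ q, ContinuousOn y (Ioc (ρ i) (ρ (i + 1)))) ∧
  (∀ i ≤ q, ∃ l, Tendsto y (𝓝[>] (ρ i)) (𝓝 l))

/-- The norm of `PC([-τ, T]; E)`. -/
def pcNorm (τ T : ℝ) (y : ℝ → E) : ℝ := supNorm (fun t : Icc (-τ) T => y t)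

/-- The extension of `χ` from `[-τ, 0]` by the constant `χ 0`. -/
def extendConst (χ : ℝ → E) (t : ℝ) : E := if t ≤ 0 then χ t else χ 0

end PiecewiseContinuous

/-! ### Constants -/

/-- `Q_i = M_α L_F (ρ (i+1)) ^ (1-α) / (1-α)`. -/
def constQ (α Mα LF : ℝ) (ρ : ℕ → ℝ) (i : ℕ) : ℝ :=
  Mα * LF * (ρ (i + 1) ^ (1 - α) / (1 - α))

/-- The constants `N_i`; here `T = ρ (q + 1)`, `c` is the norm of the constant extension of `χ`,
`B₁` is the norm of `F(0, 0)`, and `d` is the supremum over `[0, T]` of `‖(T(t) - I) χ(0)‖_α`. -/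
def constN (α η M Mα LF Mh c B₁ d : ℝ) (ρ : ℕ → ℝ) (q i : ℕ) : ℝ :=
  (if i = 0 then d else M * Mh + c) +
    Mα * (LF * (ρ (q + 1) ^ η + c) + B₁) * (ρ (i + 1) ^ (1 - α) / (1 - α))

/-- The radius `R = max (max_{0 ≤ i ≤ q} N_i / (1 - Q_i)) (M_h + c)`. -/
def constR (α η M Mα LF Mh c B₁ d : ℝ) (ρ : ℕ → ℝ) (q : ℕ) : ℝ :=
  max (⨆ i : Fin (q + 1), constN α η M Mα LF Mh c B₁ d ρ q i / (1 - constQ α Mα LF ρ i)) (Mh + c)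

section Problem

variable {𝕜 H : Type*} [RCLike 𝕜] [NormedAddCommGroup H] [InnerProductSpace 𝕜 H] [CompleteSpace H]

/-- The radius `R` attached to the data of the problem. -/
def radius (S : SpectralOperator 𝕜 H) (α : ℝ) (T : ℝ → H →L[𝕜] H) (τ : ℝ) (ρ : ℕ → ℝ) (q : ℕ)
    (χ : ℝ → S.FracSpace α) (F : ℝ → (Icc (-τ) 0 → S.FracSpace α) → H)
    (η M Mα LF Mh : ℝ) : ℝ :=
  constR α η M Mα LF Mh (pcNorm τ (ρ (q + 1)) (extendConst χ)) ‖F 0 0‖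
    (⨆ t : Icc (0 : ℝ) (ρ (q + 1)), S.fracNorm α (T t (χ 0 : H) - (χ 0 : H))) ρ q

/-- `χ` is locally Hölder continuous on `[-τ, 0]` as an `H`-valued function. -/
def IsLocallyHolder (τ : ℝ) (χ : ℝ → H) : Prop :=
  ∀ t ∈ Icc (-τ) 0, ∃ U ∈ 𝓝[Icc (-τ) 0] t, ∃ C r : NNReal, 0 < r ∧ HolderOnWith C r χ U

/-- Hypotheses on `F : [0, T] × PC([-τ, 0]; E) → H`, `T = b`: continuity for the supremum norm,
and a Hölder-Lipschitz estimate on the balls of radius `R` centred at the histories of `χbar`;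
moreover `s ↦ F(s, y_s)` is measurable for `y` in `PC([-τ, T]; E)`. -/
structure ForcingHyp {E : Type*} [NormedAddCommGroup E] (τ : ℝ) (ρ : ℕ → ℝ) (q : ℕ)
    (χbar : ℝ → E) (F : ℝ → (Icc (-τ) 0 → E) → H) (R η LF : ℝ) : Prop where
  continuousOn : ContinuousOn
    (fun p : ℝ × UniformFun (Icc (-τ) 0) E => F p.1 (UniformFun.toFun p.2))
    {p | p.1 ∈ Icc 0 (ρ (q + 1)) ∧ IsPCHistory τ (UniformFun.toFun p.2)}
  estimate : ∀ s ∈ Icc 0 (ρ (q + 1)), ∀ t ∈ Icc 0 (ρ (q + 1)), ∀ x y : Icc (-τ) 0 → E,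
    IsPCHistory τ x → IsPCHistory τ y →
    supNorm (x - hist τ χbar s) ≤ R → supNorm (y - hist τ χbar t) ≤ R →
    ‖F s x - F t y‖ ≤ LF * (|s - t| ^ η + supNorm (x - y))
  measurable : ∀ y : ℝ → E, IsPC τ ρ q y →
    AEStronglyMeasurable (fun s => F s (hist τ y s)) (volume.restrict (Icc 0 (ρ (q + 1))))

/-- Hypotheses on the impulse functions `h i : (ρ i, ς i] × E → E`, `1 ≤ i ≤ q`. -/
structure ImpulseHyp {E : Type*} [NormedAddCommGroup E] (ρ ς : ℕ → ℝ) (q : ℕ)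
    (χbar : ℝ → E) (h : ℕ → ℝ → E → E) (R Mh : ℝ) (Lh : ℕ → ℝ) : Prop where
  continuousOn : ∀ i ∈ Icc 1 q,
    ContinuousOn (fun p : ℝ × E => h i p.1 p.2) (Ioc (ρ i) (ς i) ×ˢ univ)
  estimate : ∀ i ∈ Icc 1 q, ∀ s ∈ Ioc (ρ i) (ς i), ∀ t ∈ Ioc (ρ i) (ς i), ∀ x y : E,
    ‖x - χbar s‖ ≤ R → ‖y - χbar t‖ ≤ R →
    ‖h i s x - h i t y‖ ≤ Lh i * (|s - t| + ‖x - y‖)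
  bound : ∀ i ∈ Icc 1 q, ∀ t ∈ Ioc (ρ i) (ς i), ∀ x : E, ‖h i t x‖ ≤ Mh

/-- The integral equations of the impulsive problem (with initial function `χ`, forcing `F` and
impulses `h`). For `y` in the space `PC` the left limit `y(ρ i ⁻)` is the value `y (ρ i)`. The
integrals are required to exist. -/
structure IsMildSolution [NormedSpace ℝ H] (S : SpectralOperator 𝕜 H) (α : ℝ)
    (T : ℝ → H →L[𝕜] H) (τ : ℝ) (ρ ς : ℕ → ℝ) (q : ℕ) (χ : ℝ → S.FracSpace α)
    (F : ℝ → (Icc (-τ) 0 → S.FracSpace α) → H) (h : ℕ → ℝ → S.FracSpace α → S.FracSpace α)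
    (y : ℝ → S.FracSpace α) : Prop where
  initial : ∀ t ∈ Icc (-τ) 0, y t = χ t
  first : ∀ t ∈ Icc 0 (ρ 1),
    IntervalIntegrable (fun s => T (t - s) (F s (hist τ y s))) volume 0 t ∧
    (y t : H) = T t (χ 0 : H) + ∫ s in (0 : ℝ)..t, T (t - s) (F s (hist τ y s))
  impulse : ∀ i ∈ Icc 1 q, ∀ t ∈ Ioc (ρ i) (ς i), y t = h i t (y (ρ i))
  later : ∀ i ∈ Icc 1 q, ∀ t ∈ Ioc (ς i) (ρ (i + 1)),
    IntervalIntegrable (fun s => T (t - s) (F s (hist τ y s))) volume (ς i) t ∧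
    (y t : H) = T (t - ς i) (h i (ς i) (y (ρ i)) : H) +
      ∫ s in (ς i)..t, T (t - s) (F s (hist τ y s))

/-- `F_n(s, x) = F(s, Pⁿ x)`. -/
def approxF (S : SpectralOperator 𝕜 H) {α τ : ℝ}
    (F : ℝ → (Icc (-τ) 0 → S.FracSpace α) → H) (n : ℕ) :
    ℝ → (Icc (-τ) 0 → S.FracSpace α) → H :=
  fun s x => F s (fun θ => S.proj n (x θ))

/-- `h_{i,n}(t, x) = h_i(t, Pⁿ x)`. -/
def approxH (S : SpectralOperator 𝕜 H) {α : ℝ}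
    (h : ℕ → ℝ → S.FracSpace α → S.FracSpace α) (n : ℕ) :
    ℕ → ℝ → S.FracSpace α → S.FracSpace α :=
  fun i t x => h i t (S.proj n x)

end Problem

end ImpulsiveRetarded

end

/-!
Let `E = D(A ^ α)`. On the coordinates with respect to the eigenvectors, the semigroup `T(t)` is
multiplication by `exp (-lam j * t)` (`SpectralOperator.repr_semigroup`). Hence it restricts to a
strongly continuous semigroup of contractions of `E`, it maps `H` into `E` for `t > 0`, and
`‖P T(t) x - x‖_α ≤ ‖x‖_α` whenever `P` is the identity or one of the projections `Pⁿ`, because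
`P T(t)` multiplies each coordinate by a number in `[0, 1]`. As the singularity `t ^ (-α)` of the
kernel is integrable, the convolution of the semigroup with a bounded function is a continuous
function with values in `E` (`IsParabolicKernel.continuousOn_conv`), so that the problem can be
treated in `E`.

The equation with `F` and `h i` and the approximate ones are handled together: they are the
equations in which the arguments of `F` and `h i` are precomposed with an admissible operator `P`.
The hypotheses on `F` and `h i` can be used only while `P ∘ y` is in the tube of radius `R` around
the constant extension of `χ`. Since `q ≥ 1`, the definition of `R` contains the term with
`d_i = M M_h + c`, which makes `R` so large that, by the estimate above, the integral operator
preserves the tube for every admissible `P` and on every interval (`tube_le_constR`), including the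
first one and although `Pⁿ` does not fix `χ`. There the operator is a contraction, since
`constQ < 1`, and solutions are constructed one interval at a time
(`IsTubeProblem.exists_isTubeSolution`).

Uniqueness concerns all solutions, not just those in the tube. The estimate for the integral
operator is strict at all times before the last one, so that a solution cannot leave the tube
(`IsTubeProblem.mem_tube`). This requires continuity of the solution on the closed interval. At
time `0`, an arbitrary solution is known only to have a right limit, and `F` need not be bounded
along it; `tendsto_of_mild` finds the limit by applying `T(b - t)` to the equation.

Finally, two solutions for operators `P₁` and `P₂` differ by at most `C * sup ‖P₁ z - P₂ z‖_α`,
where `z` is the second of them (`IsTubeProblem.exists_norm_sub_le`). With `P₁ = P₂` this gives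
uniqueness. With `P₁ = Pⁿ` and `P₂ = 1` it gives convergence, since the range of a piecewise
continuous function is totally bounded and `Pⁿ → 1` uniformly on totally bounded sets.
-/

namespace ImpulsiveRetarded

/-! ### The semigroup in the basis of eigenvectors -/

theorem tendsto_sub_nhdsGT_zero (t : ℝ) : Tendsto (fun s => s - t) (𝓝[>] t) (𝓝[>] 0) := by
  refine tendsto_nhdsWithin_iff.2 ⟨?_, ?_⟩
  · have : Tendsto (fun s : ℝ => s - t) (𝓝 t) (𝓝 (t - t)) := (continuous_sub_right t).tendsto t
    rw [sub_self] at this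
    exact this.mono_left nhdsWithin_le_nhds
  · filter_upwards [self_mem_nhdsWithin] with s hs
    exact mem_Ioi.2 (sub_pos.2 (mem_Ioi.1 hs))

section Semigroup

variable {𝕜 H : Type*} [RCLike 𝕜] [NormedAddCommGroup H] [InnerProductSpace 𝕜 H]

namespace IsSemigroupGeneratedByNeg

theorem continuousWithinAt_apply {A : H →ₗ.[𝕜] H} {T : ℝ → H →L[𝕜] H}
    (hT : IsSemigroupGeneratedByNeg A T) {t : ℝ} (ht : 0 ≤ t) (x : H) :
    ContinuousWithinAt (fun s => T s x) (Ici t) t := by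
  rw [← continuousWithinAt_Ioi_iff_Ici]
  have h1 := tendsto_sub_nhdsGT_zero t
  have h2 := ((T t).continuous.tendsto x).comp ((hT.strong_continuity x).comp h1)
  refine Tendsto.congr' ?_ h2
  filter_upwards [self_mem_nhdsWithin] with s hs
  have : T (t + (s - t)) = (T t).comp (T (s - t)) := hT.map_add _ _ ht (sub_pos.2 (mem_Ioi.1 hs)).le
  rw [add_sub_cancel] at this
  simp [this]

theorem continuousOn_apply {A : H →ₗ.[𝕜] H} {T : ℝ → H →L[𝕜] H}
    (hT : IsSemigroupGeneratedByNeg A T) {M : ℝ} (hM : ∀ t, 0 ≤ t → ‖T t‖ ≤ M) (x : H) :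
    ContinuousOn (fun s => T s x) (Ici 0) := by
  intro t ht
  have hsplit : Ici (0 : ℝ) ⊆ Icc 0 t ∪ Ici t := fun s hs => by
    rcases le_total s t with h | h
    · exact Or.inl ⟨hs, h⟩
    · exact Or.inr h
  refine ContinuousWithinAt.mono ?_ hsplit
  refine ContinuousWithinAt.union ?_ (hT.continuousWithinAt_apply ht x)
  -- left continuity: `T t x - T s x = T s (T (t - s) x - x)` and `T s` is bounded by `M`
  have h0 : Tendsto (fun r => T r x) (𝓝[≥] 0) (𝓝 x) := by
    have := hT.continuousWithinAt_apply le_rfl x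
    rw [ContinuousWithinAt, hT.map_zero] at this
    simpa using this
  have h1 : Tendsto (fun s => t - s) (𝓝[Icc 0 t] t) (𝓝[≥] 0) := by
    refine tendsto_nhdsWithin_iff.2 ⟨?_, ?_⟩
    · have : Tendsto (fun s : ℝ => t - s) (𝓝 t) (𝓝 (t - t)) := (continuous_sub_left t).tendsto t
      rw [sub_self] at this
      exact this.mono_left nhdsWithin_le_nhds
    · filter_upwards [self_mem_nhdsWithin] with s hs
      exact sub_nonneg.2 hs.2
  have h2 : Tendsto (fun s => M * ‖T (t - s) x - x‖) (𝓝[Icc 0 t] t) (𝓝 0) := by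
    have := ((h0.comp h1).sub_const x).norm.const_mul M
    simpa using this
  rw [ContinuousWithinAt, tendsto_iff_norm_sub_tendsto_zero]
  refine squeeze_zero' (Eventually.of_forall fun _ => norm_nonneg _) ?_ h2
  filter_upwards [self_mem_nhdsWithin] with s hs
  have : T (s + (t - s)) = (T s).comp (T (t - s)) := hT.map_add _ _ hs.1 (sub_nonneg.2 hs.2)
  rw [add_sub_cancel] at this
  rw [this, norm_sub_rev, ContinuousLinearMap.comp_apply, ← map_sub]
  exact ((T s).le_opNorm _).trans (mul_le_mul_of_nonneg_right (hM s hs.1) (norm_nonneg _))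

/-- On an eigenvector the semigroup is scalar multiplication by `exp (-l t)`: the function
`exp (l t) • T t v` has vanishing right derivative. -/
theorem apply_eigenvector [NormedSpace ℝ H] [IsScalarTower ℝ 𝕜 H] {A : H →ₗ.[𝕜] H}
    {T : ℝ → H →L[𝕜] H} (hT : IsSemigroupGeneratedByNeg A T) {M : ℝ}
    (hM : ∀ t, 0 ≤ t → ‖T t‖ ≤ M) {v : H} (hv : v ∈ A.domain) {l : ℝ}
    (hAv : A ⟨v, hv⟩ = (l : 𝕜) • v) {t : ℝ} (ht : 0 ≤ t) :
    T t v = ((Real.exp (-(l * t)) : ℝ) : 𝕜) • v := by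
  have hder : ∀ s, 0 ≤ s → HasDerivWithinAt (fun r => T r v) (-(l • T s v)) (Ici s) s := by
    intro s hs
    rw [hasDerivWithinAt_iff_tendsto_slope, Ici_sdiff_left]
    have h1 := (hT.generator v (-((l : 𝕜) • v))).1 ⟨hv, by rw [hAv]⟩
    have h2 := tendsto_sub_nhdsGT_zero s
    have h3 := ((T s).continuous.tendsto _).comp (h1.comp h2)
    have e : T s (-((l : 𝕜) • v)) = -(l • T s v) := by
      rw [map_neg, map_smul, RCLike.real_smul_eq_coe_smul (K := 𝕜)]
    rw [e] at h3
    refine h3.congr' ?_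
    filter_upwards [self_mem_nhdsWithin] with r hr
    have : T (s + (r - s)) = (T s).comp (T (r - s)) :=
      hT.map_add _ _ hs (sub_pos.2 (mem_Ioi.1 hr)).le
    rw [add_sub_cancel] at this
    rw [slope_def_module, this]
    simp only [Function.comp_apply, map_smul, map_sub, ContinuousLinearMap.comp_apply]
    rw [RCLike.real_smul_eq_coe_smul (K := 𝕜), RCLike.ofReal_inv, RCLike.ofReal_sub]
  have hexp : ∀ s, HasDerivAt (fun r : ℝ => Real.exp (l * r)) (Real.exp (l * s) * l) s := by
    intro s
    have := ((hasDerivAt_id s).const_mul l).exp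
    simpa using this
  have key := constant_of_has_deriv_right_zero (f := fun r => Real.exp (l * r) • T r v)
    (a := 0) (b := t) ?_ ?_ t ⟨ht, le_rfl⟩
  · simp only [mul_zero, Real.exp_zero, one_smul, hT.map_zero, ContinuousLinearMap.id_apply] at key
    rw [← RCLike.real_smul_eq_coe_smul (K := 𝕜), Real.exp_neg]
    exact (eq_inv_smul_iff₀ (Real.exp_pos _).ne').2 key
  · refine ContinuousOn.smul (by fun_prop) ?_
    exact (hT.continuousOn_apply hM v).mono Icc_subset_Ici_self
  · intro s hs
    have := ((hexp s).hasDerivWithinAt (s := Ici s)).smul (hder s hs.1)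
    convert! this using 1
    rw [smul_neg, smul_smul, neg_add_cancel]

end IsSemigroupGeneratedByNeg

end Semigroup

namespace SpectralOperator

variable {𝕜 H : Type*} [RCLike 𝕜] [NormedAddCommGroup H] [InnerProductSpace 𝕜 H] [CompleteSpace H]

theorem ext_repr (S : SpectralOperator 𝕜 H) {x y : H} (h : ∀ j, S.ψ.repr x j = S.ψ.repr y j) :
    x = y := by
  apply S.ψ.repr.injective
  ext j
  exact h j

theorem summable_repr_sq (S : SpectralOperator 𝕜 H) (x : H) :
    Summable fun j => ‖S.ψ.repr x j‖ ^ (2 : ℝ) := by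
  have := (memℓp_gen_iff (p := 2) (by norm_num)).1 (lp.memℓp (S.ψ.repr x))
  simpa using this

theorem norm_le_of_repr_le (S : SpectralOperator 𝕜 H) {x y : H}
    (h : ∀ j, ‖S.ψ.repr x j‖ ≤ ‖S.ψ.repr y j‖) : ‖x‖ ≤ ‖y‖ := by
  have hx := lp.norm_rpow_eq_tsum (p := 2) (by norm_num) (S.ψ.repr x)
  have hy := lp.norm_rpow_eq_tsum (p := 2) (by norm_num) (S.ψ.repr y)
  simp only [LinearIsometryEquiv.norm_map, ENNReal.toReal_ofNat] at hx hy
  have : ‖x‖ ^ (2 : ℝ) ≤ ‖y‖ ^ (2 : ℝ) := by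
    rw [hx, hy]
    exact (S.summable_repr_sq x).tsum_le_tsum
      (fun j => Real.rpow_le_rpow (norm_nonneg _) (h j) (by norm_num)) (S.summable_repr_sq y)
  exact (Real.rpow_le_rpow_iff (norm_nonneg _) (norm_nonneg _) (by norm_num)).1 this

theorem memℓp_mul (S : SpectralOperator 𝕜 H) {m : ℕ → ℝ} {C : ℝ} (hm : ∀ j, |m j| ≤ C) (x : H) :
    Memℓp (fun j => ((m j : ℝ) : 𝕜) * S.ψ.repr x j) 2 := by
  refine (memℓp_gen_iff (by norm_num)).2 ?_
  simp only [ENNReal.toReal_ofNat]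
  refine Summable.of_nonneg_of_le (fun j => by positivity) (fun j => ?_)
    ((S.summable_repr_sq x).mul_left (C ^ (2 : ℝ)))
  rw [norm_mul, RCLike.norm_ofReal, Real.mul_rpow (abs_nonneg _) (norm_nonneg _)]
  exact mul_le_mul_of_nonneg_right (Real.rpow_le_rpow (abs_nonneg _) (hm j) (by norm_num))
    (by positivity)

/-- The semigroup acts on the coordinates by multiplication with `exp (-lam j * t)`. -/
theorem repr_semigroup [NormedSpace ℝ H] [IsScalarTower ℝ 𝕜 H] (S : SpectralOperator 𝕜 H)
    {T : ℝ → H →L[𝕜] H} (hT : IsSemigroupGeneratedByNeg S.A T) {M : ℝ}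
    (hM : ∀ t, 0 ≤ t → ‖T t‖ ≤ M) {t : ℝ} (ht : 0 ≤ t) (x : H) (j : ℕ) :
    S.ψ.repr (T t x) j = ((Real.exp (-(S.lam j * t)) : ℝ) : 𝕜) * S.ψ.repr x j := by
  rw [HilbertBasis.repr_apply_apply, HilbertBasis.repr_apply_apply]
  let L₁ : H →L[𝕜] 𝕜 := (innerSL 𝕜 (S.ψ j)).comp (T t)
  let L₂ : H →L[𝕜] 𝕜 := ((Real.exp (-(S.lam j * t)) : ℝ) : 𝕜) • innerSL 𝕜 (S.ψ j)
  have : L₁ = L₂ := by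
    refine ContinuousLinearMap.ext_on
      (Submodule.dense_iff_topologicalClosure_eq_top.2 S.ψ.dense_span) ?_
    rintro _ ⟨k, rfl⟩
    simp only [L₁, L₂, ContinuousLinearMap.comp_apply, innerSL_apply_apply,
      _root_.smul_apply, smul_eq_mul]
    rw [hT.apply_eigenvector hM (S.ψ_mem k) (S.eigen k) ht, inner_smul_right]
    rcases eq_or_ne j k with rfl | hjk
    · rfl
    · rw [S.ψ.orthonormal.2 hjk, mul_zero, mul_zero]
  exact DFunLike.congr_fun this x

theorem norm_semigroup_le [NormedSpace ℝ H] [IsScalarTower ℝ 𝕜 H] (S : SpectralOperator 𝕜 H)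
    {T : ℝ → H →L[𝕜] H} (hT : IsSemigroupGeneratedByNeg S.A T) {M : ℝ}
    (hM : ∀ t, 0 ≤ t → ‖T t‖ ≤ M) {t : ℝ} (ht : 0 ≤ t) (x : H) : ‖T t x‖ ≤ ‖x‖ := by
  refine S.norm_le_of_repr_le fun j => ?_
  rw [S.repr_semigroup hT hM ht, norm_mul, RCLike.norm_ofReal, abs_of_pos (Real.exp_pos _)]
  refine mul_le_of_le_one_left (norm_nonneg _) (Real.exp_le_one_iff.2 ?_)
  have := mul_nonneg (S.lam_pos' j).le ht
  linarith

/-- The semigroup is injective, all its multipliers being nonzero. -/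
theorem semigroup_injective [NormedSpace ℝ H] [IsScalarTower ℝ 𝕜 H] (S : SpectralOperator 𝕜 H)
    {T : ℝ → H →L[𝕜] H} (hT : IsSemigroupGeneratedByNeg S.A T) {M : ℝ}
    (hM : ∀ t, 0 ≤ t → ‖T t‖ ≤ M) {t : ℝ} (ht : 0 ≤ t) : Function.Injective (T t) := by
  intro x y hxy
  refine S.ext_repr fun j => ?_
  have h1 : S.ψ.repr (T t x) j = S.ψ.repr (T t y) j := by rw [hxy]
  rw [S.repr_semigroup hT hM ht, S.repr_semigroup hT hM ht] at h1
  refine mul_left_cancel₀ ?_ h1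
  exact_mod_cast (Real.exp_pos _).ne'

/-- The semigroup maps `H` into `D(A ^ α)` at positive times. -/
theorem semigroup_mem_fracDomain [NormedSpace ℝ H] [IsScalarTower ℝ 𝕜 H]
    (S : SpectralOperator 𝕜 H) {T : ℝ → H →L[𝕜] H} (hT : IsSemigroupGeneratedByNeg S.A T) {M : ℝ}
    (hM : ∀ t, 0 ≤ t → ‖T t‖ ≤ M) {α : ℝ} (hα : α ∈ Ioo (0 : ℝ) 1) {t : ℝ} (ht : 0 < t) (x : H) :
    T t x ∈ (S.fracPow α).domain := by
  change Memℓp _ 2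
  have e : (fun j => ((S.lam j ^ α : ℝ) : 𝕜) * S.ψ.repr (T t x) j) =
      fun j => ((S.lam j ^ α * Real.exp (-(S.lam j * t)) : ℝ) : 𝕜) * S.ψ.repr x j := by
    funext j
    rw [S.repr_semigroup hT hM ht.le, RCLike.ofReal_mul, mul_assoc]
  rw [e]
  refine S.memℓp_mul (C := 1 + t⁻¹) (fun j => ?_) x
  have hl := S.lam_pos' j
  rw [abs_of_pos (by positivity)]
  -- `l ^ α ≤ 1 + l` and `l * exp (-(l * t)) ≤ t⁻¹`
  have h1 : S.lam j ^ α ≤ 1 + S.lam j := by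
    rcases le_total (S.lam j) 1 with h | h
    · have := Real.rpow_le_one hl.le h hα.1.le
      linarith
    · have := Real.rpow_le_rpow_of_exponent_le h hα.2.le
      rw [Real.rpow_one] at this
      linarith
  have h2 : Real.exp (-(S.lam j * t)) ≤ 1 :=
    Real.exp_le_one_iff.2 (by have := mul_pos hl ht; linarith)
  have h3 : S.lam j * Real.exp (-(S.lam j * t)) ≤ t⁻¹ := by
    rw [Real.exp_neg, ← div_eq_mul_inv, div_le_iff₀ (Real.exp_pos _), inv_mul_eq_div,
      le_div_iff₀ ht]
    have := Real.add_one_le_exp (S.lam j * t)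
    linarith
  calc S.lam j ^ α * Real.exp (-(S.lam j * t))
      ≤ (1 + S.lam j) * Real.exp (-(S.lam j * t)) :=
        mul_le_mul_of_nonneg_right h1 (Real.exp_pos _).le
    _ ≤ 1 + t⁻¹ := by linarith

end SpectralOperator

/-! ### The space `D(A ^ α)` -/

namespace SpectralOperator

variable {𝕜 H : Type*} [RCLike 𝕜] [NormedAddCommGroup H] [InnerProductSpace 𝕜 H] [CompleteSpace H]

namespace FracSpace

variable {S : SpectralOperator 𝕜 H} {α : ℝ}

/-- The real normed space structure of `H_α`, by restriction of scalars. -/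
noncomputable instance : NormedSpace ℝ (S.FracSpace α) :=
  NormedSpace.restrictScalars ℝ 𝕜 (S.FracSpace α)

instance : IsScalarTower ℝ 𝕜 (S.FracSpace α) :=
  RestrictScalars.isScalarTower ℝ 𝕜 (S.FracSpace α)

theorem norm_eq (x : S.FracSpace α) : ‖x‖ = ‖(pow x : H)‖ := rfl

theorem isometry_pow : Isometry (pow : S.FracSpace α →ₗ[𝕜] H) :=
  AddMonoidHomClass.isometry_of_norm _ fun _ => rfl

theorem incl_injective : Function.Injective (incl : S.FracSpace α →ₗ[𝕜] H) :=
  Subtype.val_injective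

theorem incl_mem (x : S.FracSpace α) : incl x ∈ (S.fracPow α).domain := x.2

theorem norm_le_of_repr_le {x y : S.FracSpace α}
    (h : ∀ j, ‖S.ψ.repr (incl x) j‖ ≤ ‖S.ψ.repr (incl y) j‖) : ‖x‖ ≤ ‖y‖ := by
  rw [norm_eq, norm_eq]
  refine S.norm_le_of_repr_le fun j => ?_
  rw [repr_pow, repr_pow, norm_mul, norm_mul]
  exact mul_le_mul_of_nonneg_left (h j) (norm_nonneg _)

theorem norm_incl_le (hα : 0 ≤ α) (x : S.FracSpace α) :
    ‖(incl x : H)‖ ≤ (S.lam 0 ^ α)⁻¹ * ‖x‖ := by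
  have h0 := Real.rpow_pos_of_pos S.lam_pos α
  rw [← div_eq_inv_mul, le_div_iff₀ h0]
  have : ‖(((S.lam 0 ^ α : ℝ) : 𝕜) • incl x : H)‖ ≤ ‖(pow x : H)‖ := by
    refine S.norm_le_of_repr_le fun j => ?_
    rw [repr_pow, map_smul, lp.coeFn_smul, Pi.smul_apply, smul_eq_mul, norm_mul, norm_mul]
    refine mul_le_mul_of_nonneg_right ?_ (norm_nonneg _)
    rw [RCLike.norm_ofReal, RCLike.norm_ofReal, abs_of_pos h0,
      abs_of_pos (Real.rpow_pos_of_pos (S.lam_pos' j) α)]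
    exact Real.rpow_le_rpow S.lam_pos.le (S.lam_mono (Nat.zero_le j)) hα
  rwa [norm_smul, RCLike.norm_ofReal, abs_of_pos h0, mul_comm] at this

/-- The inclusion of `H_α` in `H` as a bounded operator. -/
noncomputable def inclL (S : SpectralOperator 𝕜 H) (hα : 0 ≤ α) : S.FracSpace α →L[𝕜] H :=
  incl.mkContinuous _ (norm_incl_le hα)

end FracSpace

open FracSpace

theorem completeSpace_fracSpace (S : SpectralOperator 𝕜 H) {α : ℝ} (hα : 0 ≤ α) :
    CompleteSpace (S.FracSpace α) := by
  have hsurj : Function.Surjective (pow : S.FracSpace α →ₗ[𝕜] H) := by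
    intro y
    have h0 := Real.rpow_pos_of_pos S.lam_pos α
    have hb : ∀ j, |(S.lam j ^ α)⁻¹| ≤ (S.lam 0 ^ α)⁻¹ := fun j => by
      rw [abs_of_pos (inv_pos.2 (Real.rpow_pos_of_pos (S.lam_pos' j) α))]
      exact inv_anti₀ h0 (Real.rpow_le_rpow S.lam_pos.le (S.lam_mono (Nat.zero_le j)) hα)
    let z : H := S.ψ.repr.symm ⟨_, S.memℓp_mul hb y⟩
    have hz : ∀ j, S.ψ.repr z j = (((S.lam j ^ α)⁻¹ : ℝ) : 𝕜) * S.ψ.repr y j := fun j => by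
      simp only [z, LinearIsometryEquiv.apply_symm_apply]
    have hz' : ∀ j, ((S.lam j ^ α : ℝ) : 𝕜) * S.ψ.repr z j = S.ψ.repr y j := fun j => by
      rw [hz, ← mul_assoc, ← RCLike.ofReal_mul,
        mul_inv_cancel₀ (Real.rpow_pos_of_pos (S.lam_pos' j) α).ne', RCLike.ofReal_one, one_mul]
    have hmem : z ∈ (S.fracPow α).domain := by
      change Memℓp (fun j => ((S.lam j ^ α : ℝ) : 𝕜) * S.ψ.repr z j) 2
      rw [funext hz']
      exact lp.memℓp _
    refine ⟨⟨z, hmem⟩, S.ext_repr fun j => ?_⟩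
    exact (repr_pow _ j).trans (hz' j)
  exact (completeSpace_congr (e := Equiv.ofBijective _ ⟨pow_injective, hsurj⟩)
    isometry_pow.isUniformEmbedding).2 inferInstance

theorem repr_proj (S : SpectralOperator 𝕜 H) {α : ℝ} (n : ℕ) (x : S.FracSpace α) (j : ℕ) :
    S.ψ.repr (incl (S.proj n x)) j = if j ≤ n then S.ψ.repr (incl x) j else 0 := by
  have : (incl (S.proj n x) : H) = ∑ k ∈ Finset.range (n + 1), inner 𝕜 (S.ψ k) (incl x) • S.ψ k :=
    rfl
  rw [this, S.ψ.repr_apply_apply, inner_sum]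
  simp only [inner_smul_right, orthonormal_iff_ite.1 S.ψ.orthonormal, mul_ite, mul_one, mul_zero,
    Finset.sum_ite_eq, Finset.mem_range, Nat.lt_succ_iff, S.ψ.repr_apply_apply]

theorem norm_proj_le (S : SpectralOperator 𝕜 H) {α : ℝ} (n : ℕ) (x : S.FracSpace α) :
    ‖S.proj n x‖ ≤ ‖x‖ := by
  refine FracSpace.norm_le_of_repr_le fun j => ?_
  rw [repr_proj]
  split_ifs <;> simp

/-- The projection `Pⁿ` as a bounded operator on `H_α`. -/
noncomputable def projL (S : SpectralOperator 𝕜 H) (α : ℝ) (n : ℕ) :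
    S.FracSpace α →L[ℝ] S.FracSpace α :=
  LinearMap.mkContinuous
    { toFun := S.proj n
      map_add' := fun x y => incl_injective <| S.ext_repr fun j => by
        rw [map_add, map_add, lp.coeFn_add, Pi.add_apply]
        simp only [repr_proj, map_add, lp.coeFn_add, Pi.add_apply]
        split_ifs <;> simp
      map_smul' := fun r x => incl_injective <| S.ext_repr fun j => by
        rw [RingHom.id_apply, RCLike.real_smul_eq_coe_smul (K := 𝕜),
          RCLike.real_smul_eq_coe_smul (K := 𝕜)]
        simp only [repr_proj, map_smul, lp.coeFn_smul, Pi.smul_apply]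
        split_ifs <;> simp }
    1 fun x => by rw [one_mul]; exact S.norm_proj_le n x

theorem tendsto_proj (S : SpectralOperator 𝕜 H) {α : ℝ} (x : S.FracSpace α) :
    Tendsto (fun n => S.proj n x) atTop (𝓝 x) := by
  rw [isometry_pow.isEmbedding.tendsto_nhds_iff]
  have h := ((S.ψ.hasSum_repr (pow x)).tendsto_sum_nat).comp (tendsto_add_atTop_nat 1)
  refine h.congr fun n => S.ext_repr fun j => ?_
  simp only [Function.comp_apply]
  rw [repr_pow, repr_proj, S.ψ.repr_apply_apply, inner_sum]
  simp only [inner_smul_right, orthonormal_iff_ite.1 S.ψ.orthonormal, mul_ite, mul_one, mul_zero,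
    Finset.sum_ite_eq, Finset.mem_range, Nat.lt_succ_iff, repr_pow]

theorem exists_incl_eq (S : SpectralOperator 𝕜 H) {α : ℝ} {x : H}
    (hx : x ∈ (S.fracPow α).domain) : ∃ z : S.FracSpace α, incl z = x := ⟨⟨x, hx⟩, rfl⟩

open Classical in
/-- An element `x` of `H` lying in `D(A ^ α)`, viewed in `H_α` (and `0` for other `x`). -/
noncomputable def toFrac (S : SpectralOperator 𝕜 H) (α : ℝ) (x : H) : S.FracSpace α :=
  if hx : x ∈ (S.fracPow α).domain then (S.exists_incl_eq hx).choose else 0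

theorem incl_toFrac (S : SpectralOperator 𝕜 H) {α : ℝ} {x : H} (hx : x ∈ (S.fracPow α).domain) :
    incl (S.toFrac α x) = x := by
  rw [toFrac, dif_pos hx]
  exact (S.exists_incl_eq hx).choose_spec

theorem toFrac_incl (S : SpectralOperator 𝕜 H) {α : ℝ} (x : S.FracSpace α) :
    S.toFrac α (incl x) = x :=
  incl_injective (S.incl_toFrac (incl_mem x))

theorem semigroup_incl_mem [NormedSpace ℝ H] [IsScalarTower ℝ 𝕜 H]
    (S : SpectralOperator 𝕜 H) {T : ℝ → H →L[𝕜] H} (hT : IsSemigroupGeneratedByNeg S.A T) {M : ℝ}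
    (hM : ∀ t, 0 ≤ t → ‖T t‖ ≤ M) {α : ℝ} (hα : α ∈ Ioo (0 : ℝ) 1) {t : ℝ} (ht : 0 ≤ t)
    (x : S.FracSpace α) : T t (incl x) ∈ (S.fracPow α).domain := by
  rcases ht.eq_or_lt with rfl | ht
  · rw [hT.map_zero]
    exact incl_mem x
  · exact S.semigroup_mem_fracDomain hT hM hα ht _

section

variable [NormedSpace ℝ H] [IsScalarTower ℝ 𝕜 H]
    (S : SpectralOperator 𝕜 H) {T : ℝ → H →L[𝕜] H} (hT : IsSemigroupGeneratedByNeg S.A T) {M : ℝ}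
    (hM : ∀ t, 0 ≤ t → ‖T t‖ ≤ M) {α : ℝ} (hα : α ∈ Ioo (0 : ℝ) 1)

include hT hM hα

theorem norm_toFrac_semigroup_incl_le {t : ℝ} (ht : 0 ≤ t) (x : S.FracSpace α) :
    ‖S.toFrac α (T t (incl x))‖ ≤ ‖x‖ := by
  refine FracSpace.norm_le_of_repr_le fun j => ?_
  rw [S.incl_toFrac (S.semigroup_incl_mem hT hM hα ht x), S.repr_semigroup hT hM ht, norm_mul,
    RCLike.norm_ofReal, abs_of_pos (Real.exp_pos _)]
  refine mul_le_of_le_one_left (norm_nonneg _) (Real.exp_le_one_iff.2 ?_)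
  have := mul_nonneg (S.lam_pos' j).le ht
  linarith

theorem toFrac_semigroup_sub {t : ℝ} (ht : 0 < t) (x y : H) :
    S.toFrac α (T t (x - y)) = S.toFrac α (T t x) - S.toFrac α (T t y) := by
  have hm := fun z => S.semigroup_mem_fracDomain hT hM hα ht z
  apply incl_injective
  rw [map_sub incl, S.incl_toFrac (hm _), S.incl_toFrac (hm _), S.incl_toFrac (hm _), map_sub]

theorem toFrac_semigroup_incl_sub {t : ℝ} (ht : 0 ≤ t) (x y : S.FracSpace α) :
    S.toFrac α (T t (incl (x - y))) = S.toFrac α (T t (incl x)) - S.toFrac α (T t (incl y)) := by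
  have hm := fun z => S.semigroup_incl_mem hT hM hα ht z
  apply incl_injective
  rw [S.incl_toFrac (hm _), map_sub incl x y, map_sub incl, S.incl_toFrac (hm _),
    S.incl_toFrac (hm _), map_sub]

/-- `‖Pⁿ T(t) x - x‖_α ≤ ‖x‖_α`: on each coordinate, `Pⁿ T(t)` is multiplication by a number in
`[0, 1]`. -/
theorem norm_proj_semigroup_sub_le {t : ℝ} (ht : 0 ≤ t) (n : ℕ) (x : S.FracSpace α) :
    ‖S.proj n (S.toFrac α (T t (incl x))) - x‖ ≤ ‖x‖ := by
  refine FracSpace.norm_le_of_repr_le fun j => ?_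
  rw [map_sub, map_sub, lp.coeFn_sub, Pi.sub_apply, repr_proj,
    S.incl_toFrac (S.semigroup_incl_mem hT hM hα ht x), S.repr_semigroup hT hM ht]
  split_ifs
  · rw [← sub_one_mul, norm_mul, ← RCLike.ofReal_one, ← RCLike.ofReal_sub, RCLike.norm_ofReal]
    refine mul_le_of_le_one_left (norm_nonneg _) ?_
    have h1 := Real.exp_pos (-(S.lam j * t))
    have h2 : Real.exp (-(S.lam j * t)) ≤ 1 :=
      Real.exp_le_one_iff.2 (by have := mul_nonneg (S.lam_pos' j).le ht; linarith)
    rw [abs_le]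
    constructor <;> linarith
  · simp

theorem norm_semigroup_sub_le {t : ℝ} (ht : 0 ≤ t) (x : S.FracSpace α) :
    ‖S.toFrac α (T t (incl x)) - x‖ ≤ ‖x‖ :=
  le_of_tendsto ((S.tendsto_proj _).sub_const x).norm
    (Eventually.of_forall fun n => S.norm_proj_semigroup_sub_le hT hM hα ht n x)

/-- The semigroup is strongly continuous on `H_α`, since it commutes with `A ^ α`. -/
theorem continuousOn_toFrac_semigroup_incl (x : S.FracSpace α) :
    ContinuousOn (fun t => S.toFrac α (T t (incl x))) (Ici 0) := by
  rw [isometry_pow.isEmbedding.continuousOn_iff]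
  refine (hT.continuousOn_apply hM (pow x)).congr fun t ht => S.ext_repr fun j => ?_
  simp only [Function.comp_apply]
  rw [repr_pow, S.incl_toFrac (S.semigroup_incl_mem hT hM hα ht x), S.repr_semigroup hT hM ht,
    S.repr_semigroup hT hM ht, repr_pow, mul_left_comm]

theorem continuousOn_toFrac_semigroup (x : H) :
    ContinuousOn (fun t => S.toFrac α (T t x)) (Ioi 0) := by
  intro t₀ ht₀
  have hδ : 0 < t₀ / 2 := half_pos ht₀
  have hlt : t₀ / 2 < t₀ := half_lt_self ht₀
  have h1 : ContinuousAt (fun t => S.toFrac α (T (t - t₀ / 2)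
      (incl (S.toFrac α (T (t₀ / 2) x))))) t₀ := by
    have := (S.continuousOn_toFrac_semigroup_incl hT hM hα
      (S.toFrac α (T (t₀ / 2) x))).continuousAt (Ici_mem_nhds (sub_pos.2 hlt))
    exact ContinuousAt.comp (f := fun t : ℝ => t - t₀ / 2) this (by fun_prop)
  refine ContinuousAt.continuousWithinAt (h1.congr ?_)
  filter_upwards [Ioi_mem_nhds hlt] with t ht
  have : T ((t - t₀ / 2) + t₀ / 2) = (T (t - t₀ / 2)).comp (T (t₀ / 2)) :=
    hT.map_add _ _ (sub_nonneg.2 (le_of_lt ht)) hδ.le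
  rw [sub_add_cancel] at this
  rw [S.incl_toFrac (S.semigroup_mem_fracDomain hT hM hα hδ x), this]
  rfl

/-- Strong measurability of `s ↦ T(g s) f(s)` as an `H_α`-valued function: it is the limit of its
projections `Pⁿ`, which are finite sums of scalar measurable multiples of eigenvectors. -/
theorem aestronglyMeasurable_toFrac_semigroup {X : Type*} [MeasurableSpace X] {μ : Measure X}
    {g : X → ℝ} (hg : Measurable g) (hg0 : ∀ᵐ s ∂μ, 0 < g s) {f : X → H}
    (hf : AEStronglyMeasurable f μ) :
    AEStronglyMeasurable (fun s => S.toFrac α (T (g s) (f s))) μ := by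
  let e : ℕ → S.FracSpace α := fun j => ⟨S.ψ j, S.ψ_mem_fracDomain α j⟩
  have hmeas : ∀ n : ℕ, AEStronglyMeasurable (fun s => ∑ j ∈ Finset.range (n + 1),
      (((Real.exp (-(S.lam j * g s)) : ℝ) : 𝕜) * inner 𝕜 (S.ψ j) (f s)) • e j) μ := by
    intro n
    refine Finset.aestronglyMeasurable_fun_sum _ fun j _ => ?_
    refine AEStronglyMeasurable.smul_const (AEStronglyMeasurable.mul ?_ ?_) _
    · refine RCLike.continuous_ofReal.comp_aestronglyMeasurable ?_
      exact (Real.measurable_exp.comp ((hg.const_mul _).neg)).aestronglyMeasurable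
    · exact aestronglyMeasurable_const.inner hf
  refine aestronglyMeasurable_of_tendsto_ae atTop hmeas ?_
  filter_upwards [hg0] with s hs
  refine (S.tendsto_proj (S.toFrac α (T (g s) (f s)))).congr fun n => ?_
  apply incl_injective
  refine S.ext_repr fun j => ?_
  rw [repr_proj, S.incl_toFrac (S.semigroup_mem_fracDomain hT hM hα hs _), map_sum,
    S.repr_semigroup hT hM hs.le]
  have he : ∀ k, (incl (e k) : H) = S.ψ k := fun _ => rfl
  rw [S.ψ.repr_apply_apply, S.ψ.repr_apply_apply, inner_sum]
  simp only [map_smul, he, inner_smul_right, orthonormal_iff_ite.1 S.ψ.orthonormal, mul_ite,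
    mul_one, mul_zero, Finset.sum_ite_eq, Finset.mem_range, Nat.lt_succ_iff]

end

end SpectralOperator

/-! ### Convolution with a weakly singular kernel -/

/-- The properties of a semigroup that the integral equation uses, stated for its two incarnations:
`U t : E → E` is a strongly continuous family of contractions of the phase space `E`, and
`K t : H → E`, `t > 0`, is a smoothing kernel with the singularity `t ^ (-α)` at `0`. -/
structure IsParabolicKernel {E H : Type*} [NormedAddCommGroup E] [NormedAddCommGroup H]
    (U : ℝ → E → E) (K : ℝ → H → E) (α Mα : ℝ) : Prop where
  exponent_lt : α < 1
  const_nonneg : 0 ≤ Mα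
  U_zero : ∀ x, U 0 x = x
  U_sub : ∀ t, 0 ≤ t → ∀ x y, U t (x - y) = U t x - U t y
  U_norm_le : ∀ t, 0 ≤ t → ∀ x, ‖U t x‖ ≤ ‖x‖
  U_continuousOn : ∀ x, ContinuousOn (fun t => U t x) (Ici 0)
  K_sub : ∀ t, 0 < t → ∀ x y, K t (x - y) = K t x - K t y
  K_norm_le : ∀ t, 0 < t → ∀ x, ‖K t x‖ ≤ Mα * t ^ (-α) * ‖x‖
  K_continuousOn : ∀ x, ContinuousOn (fun t => K t x) (Ioi 0)
  K_measurable : ∀ {μ : Measure ℝ} {g : ℝ → ℝ} {f : ℝ → H}, Measurable g → (∀ᵐ s ∂μ, 0 < g s) →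
    AEStronglyMeasurable f μ → AEStronglyMeasurable (fun s => K (g s) (f s)) μ

theorem intervalIntegrable_sub_rpow {α : ℝ} (hα : α < 1) (a t : ℝ) :
    IntervalIntegrable (fun s => (t - s) ^ (-α)) volume a t := by
  have h := (intervalIntegral.intervalIntegrable_rpow' (a := t - a) (b := 0) (r := -α)
    (by linarith)).comp_sub_left t
  simpa using h

theorem integral_sub_rpow {α : ℝ} (hα : α < 1) (a t : ℝ) :
    ∫ s in a..t, (t - s) ^ (-α) = (t - a) ^ (1 - α) / (1 - α) := by
  have h := intervalIntegral.integral_comp_sub_left (fun r : ℝ => r ^ (-α)) t (a := a) (b := t)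
  rw [h, sub_self, integral_rpow (Or.inl (by linarith)), Real.zero_rpow (by linarith), sub_zero,
    neg_add_eq_sub]

namespace IsParabolicKernel

variable {E H : Type*} [NormedAddCommGroup E] [NormedSpace ℝ E] [NormedAddCommGroup H]
  {U : ℝ → E → E} {K : ℝ → H → E} {α Mα : ℝ}

omit [NormedSpace ℝ E] in
theorem ae_norm_le (hK : IsParabolicKernel U K α Mα) {a t C : ℝ} {f : ℝ → H}
    (hC : ∀ s ∈ Ioo a t, ‖f s‖ ≤ C) :
    ∀ᵐ s : ℝ, s ∈ Ioc a t → ‖K (t - s) (f s)‖ ≤ Mα * C * (t - s) ^ (-α) := by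
  have hne : ∀ᵐ s : ℝ, s ≠ t := by simp [ae_iff]
  filter_upwards [hne] with s hs hst
  have hlt : s < t := lt_of_le_of_ne hst.2 hs
  refine (hK.K_norm_le _ (sub_pos.2 hlt) _).trans ?_
  have h1 := Real.rpow_nonneg (sub_nonneg.2 hlt.le) (-α)
  calc Mα * (t - s) ^ (-α) * ‖f s‖ ≤ Mα * (t - s) ^ (-α) * C :=
        mul_le_mul_of_nonneg_left (hC s ⟨hst.1, hlt⟩) (mul_nonneg hK.const_nonneg h1)
    _ = Mα * C * (t - s) ^ (-α) := by ring

omit [NormedSpace ℝ E] in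
theorem aestronglyMeasurable_conv (hK : IsParabolicKernel U K α Mα) {a t : ℝ} {f : ℝ → H}
    (hf : AEStronglyMeasurable f (volume.restrict (Ioc a t))) :
    AEStronglyMeasurable (fun s => K (t - s) (f s)) (volume.restrict (Ioc a t)) := by
  refine hK.K_measurable (by fun_prop) ?_ hf
  have hne : ∀ᵐ s : ℝ, s ≠ t := by simp [ae_iff]
  filter_upwards [ae_restrict_of_ae hne, ae_restrict_mem measurableSet_Ioc] with s hs hst
  exact sub_pos.2 (lt_of_le_of_ne hst.2 hs)

omit [NormedSpace ℝ E] in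
theorem intervalIntegrable_conv (hK : IsParabolicKernel U K α Mα) {a t C : ℝ} (hat : a ≤ t)
    {f : ℝ → H} (hf : AEStronglyMeasurable f (volume.restrict (Ioc a t)))
    (hC : ∀ s ∈ Ioo a t, ‖f s‖ ≤ C) :
    IntervalIntegrable (fun s => K (t - s) (f s)) volume a t := by
  refine ((intervalIntegrable_sub_rpow hK.exponent_lt a t).const_mul (Mα * C)).mono_fun' ?_ ?_
  · rw [uIoc_of_le hat]
    exact hK.aestronglyMeasurable_conv hf
  · rw [uIoc_of_le hat, EventuallyLE, ae_restrict_iff' measurableSet_Ioc]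
    exact hK.ae_norm_le hC

theorem norm_conv_le (hK : IsParabolicKernel U K α Mα) {a t C : ℝ} (hat : a ≤ t) {f : ℝ → H}
    (hC : ∀ s ∈ Ioo a t, ‖f s‖ ≤ C) :
    ‖∫ s in a..t, K (t - s) (f s)‖ ≤ Mα * C * ((t - a) ^ (1 - α) / (1 - α)) := by
  have h := intervalIntegral.norm_integral_le_of_norm_le hat (hK.ae_norm_le hC)
    ((intervalIntegrable_sub_rpow hK.exponent_lt a t).const_mul (Mα * C))
  rwa [intervalIntegral.integral_const_mul, integral_sub_rpow hK.exponent_lt] at h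

theorem norm_conv_sub_conv_le (hK : IsParabolicKernel U K α Mα) {a t C D : ℝ} (hat : a ≤ t)
    {f g : ℝ → H} (hf : AEStronglyMeasurable f (volume.restrict (Ioc a t)))
    (hg : AEStronglyMeasurable g (volume.restrict (Ioc a t)))
    (hCf : ∀ s ∈ Ioo a t, ‖f s‖ ≤ C) (hCg : ∀ s ∈ Ioo a t, ‖g s‖ ≤ C)
    (hD : ∀ s ∈ Ioo a t, ‖f s - g s‖ ≤ D) :
    ‖(∫ s in a..t, K (t - s) (f s)) - ∫ s in a..t, K (t - s) (g s)‖ ≤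
      Mα * D * ((t - a) ^ (1 - α) / (1 - α)) := by
  rw [← intervalIntegral.integral_sub (hK.intervalIntegrable_conv hat hf hCf)
    (hK.intervalIntegrable_conv hat hg hCg)]
  have hne : ∀ᵐ s : ℝ, s ≠ t := by simp [ae_iff]
  have e : ∫ s in a..t, (K (t - s) (f s) - K (t - s) (g s)) =
      ∫ s in a..t, K (t - s) (f s - g s) := by
    refine intervalIntegral.integral_congr_ae ?_
    filter_upwards [hne] with s hs hst
    rw [uIoc_of_le hat] at hst
    rw [hK.K_sub _ (sub_pos.2 (lt_of_le_of_ne hst.2 hs))]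
  rw [e]
  exact hK.norm_conv_le hat hD

/-- The convolution with the kernel truncated at time `ε`, whose singularity is thereby removed, is
continuous. -/
theorem continuousOn_truncated_conv (hK : IsParabolicKernel U K α Mα) (hα : 0 ≤ α)
    {a b C ε : ℝ} (hε : 0 < ε) {f : ℝ → H}
    (hf : AEStronglyMeasurable f (volume.restrict (Ioc a b)))
    (hC : ∀ s ∈ Icc a b, ‖f s‖ ≤ C) :
    ContinuousOn (fun t => ∫ s in a..t, K (max (t - s) ε) (f s)) (Icc a b) := by
  -- extend `f` by `0` in order to have room on both sides of `[a, b]`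
  set g : ℝ → H := (Ioc a b).indicator f with hg
  have hgm : AEStronglyMeasurable g volume :=
    (aestronglyMeasurable_indicator_iff measurableSet_Ioc).2 hf
  intro t₀ ht₀
  have hC0 : 0 ≤ C := (norm_nonneg _).trans (hC t₀ ht₀)
  have hgC : ∀ s, ‖g s‖ ≤ C := fun s => by
    rw [hg]
    by_cases hs : s ∈ Ioc a b
    · rw [indicator_of_mem hs]
      exact hC s (Ioc_subset_Icc_self hs)
    · rw [indicator_of_notMem hs, norm_zero]
      exact hC0
  have hcont : ContinuousAt (fun p : ℝ × ℝ => ∫ s in a..p.2, K (max (p.1 - s) ε) (g s))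
      (t₀, t₀) := by
    refine intervalIntegral.continuousAt_parametric_primitive_of_dominated (X := ℝ)
      (F := fun x s => K (max (x - s) ε) (g s)) (fun _ => Mα * ε ^ (-α) * C) (a - 1) (b + 1)
      (fun x => ?_) ?_ ?_ ?_ ?_ ?_ ?_
    · refine hK.K_measurable (by fun_prop) ?_ hgm.restrict
      exact Eventually.of_forall fun s => lt_max_of_lt_right hε
    · refine Eventually.of_forall fun x => Eventually.of_forall fun s => ?_
      have h0 : 0 < max (x - s) ε := lt_max_of_lt_right hε
      refine (hK.K_norm_le _ h0 _).trans ?_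
      have h1 : max (x - s) ε ^ (-α) ≤ ε ^ (-α) :=
        Real.rpow_le_rpow_of_nonpos hε (le_max_right _ _) (by linarith)
      have h2 := Real.rpow_nonneg hε.le (-α)
      exact mul_le_mul (mul_le_mul_of_nonneg_left h1 hK.const_nonneg) (hgC s) (norm_nonneg _)
        (mul_nonneg hK.const_nonneg h2)
    · exact intervalIntegrable_const
    · refine Eventually.of_forall fun s => ?_
      have h0 : 0 < max (t₀ - s) ε := lt_max_of_lt_right hε
      have := (hK.K_continuousOn (g s)).continuousAt (Ioi_mem_nhds h0)
      exact ContinuousAt.comp (f := fun t : ℝ => max (t - s) ε) this (by fun_prop)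
    · constructor <;> linarith [ht₀.1, ht₀.2]
    · constructor <;> linarith [ht₀.1, ht₀.2]
    · simp
  have hdiag : ContinuousAt (fun t => ∫ s in a..t, K (max (t - s) ε) (g s)) t₀ :=
    ContinuousAt.comp (f := fun t : ℝ => (t, t)) hcont (by fun_prop)
  refine hdiag.continuousWithinAt.congr (fun t ht => ?_) ?_
  · refine intervalIntegral.integral_congr_ae (Eventually.of_forall fun s hs => ?_)
    rw [uIoc_of_le ht.1] at hs
    rw [hg, indicator_of_mem (show s ∈ Ioc a b from ⟨hs.1, hs.2.trans ht.2⟩)]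
  · refine intervalIntegral.integral_congr_ae (Eventually.of_forall fun s hs => ?_)
    rw [uIoc_of_le ht₀.1] at hs
    rw [hg, indicator_of_mem (show s ∈ Ioc a b from ⟨hs.1, hs.2.trans ht₀.2⟩)]

theorem norm_conv_sub_truncated_le (hK : IsParabolicKernel U K α Mα) (hα : 0 ≤ α) {a t C ε : ℝ}
    (hat : a ≤ t) (hε : 0 < ε) {f : ℝ → H}
    (hf : AEStronglyMeasurable f (volume.restrict (Ioc a t)))
    (hC : ∀ s ∈ Icc a t, ‖f s‖ ≤ C) :
    ‖(∫ s in a..t, K (t - s) (f s)) - ∫ s in a..t, K (max (t - s) ε) (f s)‖ ≤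
      2 * Mα * C * (ε ^ (1 - α) / (1 - α)) := by
  have hα1 := hK.exponent_lt
  have hC0 : 0 ≤ C := (norm_nonneg _).trans (hC t ⟨hat, le_rfl⟩)
  have hMC : 0 ≤ Mα * C := mul_nonneg hK.const_nonneg hC0
  have hne : ∀ᵐ s : ℝ, s ≠ t := by simp [ae_iff]
  have hbd : ∀ s ∈ Ioo a t, ‖K (max (t - s) ε) (f s)‖ ≤ Mα * C * (t - s) ^ (-α) := by
    intro s hs
    have h0 : 0 < t - s := sub_pos.2 hs.2
    refine (hK.K_norm_le _ (h0.trans_le (le_max_left _ _)) _).trans ?_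
    have h1 : max (t - s) ε ^ (-α) ≤ (t - s) ^ (-α) :=
      Real.rpow_le_rpow_of_nonpos h0 (le_max_left _ _) (by linarith)
    have h2 := Real.rpow_nonneg h0.le (-α)
    calc Mα * max (t - s) ε ^ (-α) * ‖f s‖ ≤ Mα * (t - s) ^ (-α) * C :=
          mul_le_mul (mul_le_mul_of_nonneg_left h1 hK.const_nonneg)
            (hC s (Ioo_subset_Icc_self hs)) (norm_nonneg _) (mul_nonneg hK.const_nonneg h2)
      _ = _ := by ring
  have hint1 := hK.intervalIntegrable_conv hat hf fun s hs => hC s (Ioo_subset_Icc_self hs)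
  have hint2 : IntervalIntegrable (fun s => K (max (t - s) ε) (f s)) volume a t := by
    refine ((intervalIntegrable_sub_rpow hα1 a t).const_mul (Mα * C)).mono_fun' ?_ ?_
    · rw [uIoc_of_le hat]
      refine hK.K_measurable (by fun_prop) ?_ hf
      exact Eventually.of_forall fun s => lt_max_of_lt_right hε
    · rw [uIoc_of_le hat, EventuallyLE, ae_restrict_iff' measurableSet_Ioc]
      filter_upwards [hne] with s hs hst
      exact hbd s ⟨hst.1, lt_of_le_of_ne hst.2 hs⟩
  -- the two integrands agree up to time `m`
  set m := max a (t - ε) with hm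
  have ham : a ≤ m := le_max_left _ _
  have hmt : m ≤ t := max_le hat (by linarith)
  have hma : m ∈ uIcc a t := by rw [uIcc_of_le hat]; exact ⟨ham, hmt⟩
  rw [← intervalIntegral.integral_sub hint1 hint2]
  have hdiff := hint1.sub hint2
  rw [← intervalIntegral.integral_add_adjacent_intervals
    (hdiff.mono_set (uIcc_subset_uIcc_left hma)) (hdiff.mono_set (uIcc_subset_uIcc_right hma))]
  have hzero : ∫ s in a..m, (K (t - s) (f s) - K (max (t - s) ε) (f s)) = 0 := by
    rw [intervalIntegral.integral_congr_ae (g := fun _ => (0 : E)), intervalIntegral.integral_zero]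
    refine Eventually.of_forall fun s hs => ?_
    rw [uIoc_of_le ham] at hs
    have hle : s ≤ t - ε := (le_max_iff.1 hs.2).resolve_left (not_le.2 hs.1)
    rw [max_eq_left (by linarith), sub_self]
  rw [hzero, zero_add]
  have hle : ∀ᵐ s : ℝ, s ∈ Ioc m t → ‖K (t - s) (f s) - K (max (t - s) ε) (f s)‖ ≤
      2 * (Mα * C) * (t - s) ^ (-α) := by
    filter_upwards [hne, hK.ae_norm_le fun s hs => hC s (Ioo_subset_Icc_self hs)] with s hs h1 hst
    have hst' : s ∈ Ioc a t := ⟨ham.trans_lt hst.1, hst.2⟩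
    have h2 := hbd s ⟨hst'.1, lt_of_le_of_ne hst.2 hs⟩
    have h3 := norm_sub_le (K (t - s) (f s)) (K (max (t - s) ε) (f s))
    linarith [h1 hst']
  have h := intervalIntegral.norm_integral_le_of_norm_le hmt hle
    ((intervalIntegrable_sub_rpow hα1 m t).const_mul (2 * (Mα * C)))
  rw [intervalIntegral.integral_const_mul, integral_sub_rpow hα1] at h
  refine h.trans ?_
  rw [← mul_assoc]
  refine mul_le_mul_of_nonneg_left ?_ (by rw [mul_assoc]; positivity)
  refine div_le_div_of_nonneg_right ?_ (by linarith)
  refine Real.rpow_le_rpow (by linarith) ?_ (by linarith)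
  linarith [le_max_right a (t - ε)]

/-- The convolution of the kernel with a bounded function is continuous, as a uniform limit of
convolutions with truncated kernels. -/
theorem continuousOn_conv (hK : IsParabolicKernel U K α Mα) (hα : 0 ≤ α)
    {a b C : ℝ} {f : ℝ → H} (hf : AEStronglyMeasurable f (volume.restrict (Ioc a b)))
    (hC : ∀ s ∈ Icc a b, ‖f s‖ ≤ C) :
    ContinuousOn (fun t => ∫ s in a..t, K (t - s) (f s)) (Icc a b) := by
  have hα1 : 0 < 1 - α := sub_pos.2 hK.exponent_lt
  have hlim : Tendsto (fun ε : ℝ => 2 * Mα * C * (ε ^ (1 - α) / (1 - α))) (𝓝[>] 0) (𝓝 0) := by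
    have h1 : Tendsto (fun ε : ℝ => ε ^ (1 - α)) (𝓝[>] 0) (𝓝 0) := by
      have := (Real.continuousAt_rpow_const 0 (1 - α) (Or.inr hα1.le)).tendsto
      rw [Real.zero_rpow hα1.ne'] at this
      exact this.mono_left nhdsWithin_le_nhds
    simpa using (h1.div_const (1 - α)).const_mul (2 * Mα * C)
  refine TendstoUniformlyOn.continuousOn (p := 𝓝[>] (0 : ℝ))
    (F := fun ε t => ∫ s in a..t, K (max (t - s) ε) (f s)) ?_ ?_
  · rw [Metric.tendstoUniformlyOn_iff]
    intro δ hδ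
    filter_upwards [self_mem_nhdsWithin, hlim (gt_mem_nhds hδ)] with ε hε hεδ t ht
    rw [dist_eq_norm]
    refine (hK.norm_conv_sub_truncated_le hα ht.1 hε
      (hf.mono_measure (Measure.restrict_mono (Ioc_subset_Ioc_right ht.2) le_rfl))
      fun s hs => hC s ⟨hs.1, hs.2.trans ht.2⟩).trans_lt hεδ
  · refine Eventually.frequently ?_
    filter_upwards [self_mem_nhdsWithin] with ε hε
    exact hK.continuousOn_truncated_conv hα hε hf hC

end IsParabolicKernel

/-! ### Piecewise continuous functions -/

theorem knots_lt {ρ : ℕ → ℝ} {q : ℕ} (hρ : ∀ i ≤ q, ρ i < ρ (i + 1)) {i j : ℕ} (hij : i < j)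
    (hj : j ≤ q + 1) : ρ i < ρ j := by
  induction j, hij using Nat.le_induction with
  | base => exact hρ i (by omega)
  | succ k hk ih => exact (ih (by omega)).trans (hρ k (by omega))

theorem knots_le {ρ : ℕ → ℝ} {q : ℕ} (hρ : ∀ i ≤ q, ρ i < ρ (i + 1)) {i j : ℕ} (hij : i ≤ j)
    (hj : j ≤ q + 1) : ρ i ≤ ρ j := by
  rcases hij.eq_or_lt with rfl | h
  · exact le_rfl
  · exact (knots_lt hρ h hj).le

theorem exists_mem_Ioc_knots {ρ : ℕ → ℝ} (hρ0 : ρ 0 = 0) {k : ℕ} {t : ℝ} (ht : t ∈ Ioc 0 (ρ k)) :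
    ∃ i < k, t ∈ Ioc (ρ i) (ρ (i + 1)) := by
  induction k with
  | zero =>
    rw [hρ0] at ht
    exact absurd ht.2 (not_le.2 ht.1)
  | succ k ih =>
    rcases le_or_gt t (ρ k) with h | h
    · obtain ⟨i, hi, hit⟩ := ih ⟨ht.1, h⟩
      exact ⟨i, by omega, hit⟩
    · exact ⟨k, by omega, h, ht.2⟩

namespace IsPC

variable {E : Type*} [NormedAddCommGroup E] {τ : ℝ} {ρ : ℕ → ℝ} {q : ℕ}

theorem comp_clm [NormedSpace ℝ E] {y : ℝ → E} (hy : IsPC τ ρ q y) (P : E →L[ℝ] E) :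
    IsPC τ ρ q fun t => P (y t) := by
  refine ⟨⟨fun θ => ?_, fun θ => ?_, ?_⟩, fun i hi => ?_, fun i hi => ?_⟩
  · exact P.continuous.continuousAt.comp_continuousWithinAt (hy.1.1 θ)
  · obtain ⟨l, hl⟩ := hy.1.2.1 θ
    exact ⟨P l, (P.continuous.tendsto l).comp hl⟩
  · refine hy.1.2.2.subset fun θ hθ hc => hθ ?_
    exact P.continuous.continuousAt.comp (f := fun θ : Icc (-τ) 0 => y θ) hc
  · exact P.continuous.comp_continuousOn (hy.2.1 i hi)
  · obtain ⟨l, hl⟩ := hy.2.2 i hi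
    exact ⟨P l, (P.continuous.tendsto l).comp hl⟩

theorem continuousWithinAt_left (hρ0 : ρ 0 = 0) {y : ℝ → E} (hy : IsPC τ ρ q y) {t : ℝ}
    (ht : t ∈ Icc (-τ) (ρ (q + 1))) : ContinuousWithinAt y (Icc (-τ) t) t := by
  rcases le_or_gt t 0 with h0 | h0
  · have h := hy.1.1 ⟨t, ht.1, h0⟩
    have h' : Tendsto y (map Subtype.val (𝓝[Iic (⟨t, ht.1, h0⟩ : Icc (-τ) 0)] ⟨t, ht.1, h0⟩))
        (𝓝 (y t)) := tendsto_map'_iff.2 h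
    rw [Topology.IsEmbedding.subtypeVal.map_nhdsWithin_eq] at h'
    refine h'.mono_left (nhdsWithin_mono _ fun s hs => ?_)
    exact ⟨⟨s, hs.1, hs.2.trans h0⟩, hs.2, rfl⟩
  · obtain ⟨i, hi, hti⟩ := exists_mem_Ioc_knots hρ0 ⟨h0, ht.2⟩
    refine (hy.2.1 i (by omega) t hti).mono_of_mem_nhdsWithin ?_
    filter_upwards [self_mem_nhdsWithin, mem_nhdsWithin_of_mem_nhds (Ioi_mem_nhds hti.1)]
      with s hs hs'
    exact ⟨hs', hs.2.trans hti.2⟩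

theorem exists_tendsto_right (hρ0 : ρ 0 = 0) {y : ℝ → E} (hy : IsPC τ ρ q y) {t : ℝ}
    (ht : t ∈ Ico (-τ) (ρ (q + 1))) : ∃ l, Tendsto y (𝓝[>] t) (𝓝 l) := by
  rcases lt_trichotomy t 0 with h0 | rfl | h0
  · obtain ⟨l, hl⟩ := hy.1.2.1 ⟨t, ht.1, h0.le⟩
    refine ⟨l, ?_⟩
    have h' : Tendsto y (map Subtype.val (𝓝[Ioi (⟨t, ht.1, h0.le⟩ : Icc (-τ) 0)]
        ⟨t, ht.1, h0.le⟩)) (𝓝 l) := tendsto_map'_iff.2 hl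
    rw [Topology.IsEmbedding.subtypeVal.map_nhdsWithin_eq] at h'
    rw [← nhdsWithin_Ioc_eq_nhdsGT h0]
    refine h'.mono_left (nhdsWithin_mono _ fun s hs => ?_)
    exact ⟨⟨s, ht.1.trans hs.1.le, hs.2⟩, hs.1, rfl⟩
  · have := hy.2.2 0 (Nat.zero_le q)
    rwa [hρ0] at this
  · obtain ⟨i, hi, hti⟩ := exists_mem_Ioc_knots hρ0 ⟨h0, ht.2.le⟩
    rcases hti.2.eq_or_lt with h | h
    · rw [h]
      refine hy.2.2 (i + 1) ?_
      by_contra hc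
      obtain rfl : i = q := by omega
      exact absurd h ht.2.ne
    · refine ⟨y t, ?_⟩
      exact ((hy.2.1 i (by omega)).continuousAt (Ioc_mem_nhds hti.1 h)).tendsto.mono_left
        nhdsWithin_le_nhds

theorem finite_discontinuities (hρ0 : ρ 0 = 0) {y : ℝ → E} (hy : IsPC τ ρ q y) :
    {t | t ∈ Ioo (-τ) (ρ (q + 1)) ∧ ¬ ContinuousAt y t}.Finite := by
  refine ((hy.1.2.2.image Subtype.val).union ((Set.finite_Iic (q + 1)).image ρ)).subset ?_
  rintro t ⟨ht, hc⟩
  rcases lt_trichotomy t 0 with h0 | rfl | h0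
  · refine Or.inl ⟨⟨t, ht.1.le, h0.le⟩, fun h => hc ?_, rfl⟩
    have h1 : ContinuousWithinAt y (Icc (-τ) 0) t :=
      (continuousWithinAt_iff_continuousAt_domRestrict y (s := Icc (-τ) 0) ⟨ht.1.le, h0.le⟩).2 h
    exact h1.continuousAt (Icc_mem_nhds ht.1 h0)
  · exact Or.inr ⟨0, Nat.zero_le _, hρ0⟩
  · obtain ⟨i, hi, hti⟩ := exists_mem_Ioc_knots hρ0 ⟨h0, ht.2.le⟩
    rcases hti.2.eq_or_lt with h | h
    · exact Or.inr ⟨i + 1, show i + 1 ≤ q + 1 by omega, h.symm⟩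
    · exact absurd ((hy.2.1 i (by omega)).continuousAt (Ioc_mem_nhds hti.1 h)) hc

theorem isPCHistory_hist (hρ0 : ρ 0 = 0) {y : ℝ → E} (hy : IsPC τ ρ q y)
    {s : ℝ} (hs : s ∈ Icc 0 (ρ (q + 1))) : IsPCHistory τ (hist τ y s) := by
  have hφ : Continuous fun θ : Icc (-τ) 0 => s + (θ : ℝ) := by fun_prop
  refine ⟨fun θ => ?_, fun θ => ?_, ?_⟩
  · have hmem : s + (θ : ℝ) ∈ Icc (-τ) (ρ (q + 1)) :=
      ⟨by linarith [θ.2.1, hs.1], by linarith [θ.2.2, hs.2]⟩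
    refine ContinuousWithinAt.comp (f := fun θ : Icc (-τ) 0 => s + (θ : ℝ))
      (hy.continuousWithinAt_left hρ0 hmem) hφ.continuousWithinAt fun θ' hθ' => ?_
    have h1 : (θ' : ℝ) ≤ θ := hθ'
    exact ⟨by linarith [θ'.2.1, hs.1], by linarith⟩
  · rcases eq_or_lt_of_le θ.2.2 with h0 | h0
    · refine ⟨0, ?_⟩
      have : Ioi θ = ∅ := by
        ext θ'
        simp only [mem_Ioi, mem_empty_iff_false, iff_false, not_lt]
        have : (θ' : ℝ) ≤ θ := by rw [h0]; exact θ'.2.2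
        exact this
      rw [this, nhdsWithin_empty]
      exact tendsto_bot
    · obtain ⟨l, hl⟩ := hy.exists_tendsto_right hρ0 (t := s + θ)
        ⟨by linarith [θ.2.1, hs.1], by linarith [hs.2]⟩
      refine ⟨l, hl.comp ?_⟩
      refine hφ.continuousWithinAt.tendsto_nhdsWithin fun θ' hθ' => ?_
      have h1 : (θ : ℝ) < θ' := hθ'
      exact mem_Ioi.2 (by linarith)
  · have hfin := (hy.finite_discontinuities hρ0).preimage
      (f := fun θ : Icc (-τ) 0 => s + (θ : ℝ)) fun a _ b _ hab => Subtype.ext (add_left_cancel hab)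
    have hends : {θ : Icc (-τ) 0 | (θ : ℝ) = -τ ∨ (θ : ℝ) = 0}.Finite :=
      ((Set.toFinite {-τ, (0 : ℝ)}).preimage Subtype.val_injective.injOn).subset fun θ hθ => hθ
    refine (hfin.union hends).subset fun θ hθ => ?_
    by_cases he : (θ : ℝ) = -τ ∨ (θ : ℝ) = 0
    · exact Or.inr he
    · push Not at he
      have h1 := lt_of_le_of_ne θ.2.1 (Ne.symm he.1)
      have h2 := lt_of_le_of_ne θ.2.2 he.2
      refine Or.inl ⟨⟨by linarith [hs.1], by linarith [hs.2]⟩, fun hc => hθ ?_⟩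
      exact ContinuousAt.comp (f := fun θ : Icc (-τ) 0 => s + (θ : ℝ)) hc hφ.continuousAt

theorem totallyBounded_image (hρ0 : ρ 0 = 0) {y : ℝ → E} (hy : IsPC τ ρ q y) :
    TotallyBounded (y '' Icc (-τ) (ρ (q + 1))) := by
  rw [Metric.totallyBounded_iff]
  intro ε hε
  refine isCompact_Icc.induction_on
    (p := fun u => ∃ L : Set E, L.Finite ∧ y '' u ⊆ ⋃ l ∈ L, Metric.ball l ε) ?_ ?_ ?_ ?_
  · exact ⟨∅, Set.finite_empty, by simp⟩
  · rintro u v huv ⟨L, hL, h⟩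
    exact ⟨L, hL, (image_mono huv).trans h⟩
  · rintro u v ⟨L, hL, h⟩ ⟨L', hL', h'⟩
    refine ⟨L ∪ L', hL.union hL', ?_⟩
    rw [image_union, biUnion_union]
    exact union_subset_union h h'
  · intro t ht
    obtain ⟨l, hl⟩ : ∃ l, Tendsto y (𝓝[Ioc t (ρ (q + 1))] t) (𝓝 l) := by
      rcases ht.2.eq_or_lt with h | h
      · rw [← h, Ioc_self, nhdsWithin_empty]
        exact ⟨0, tendsto_bot⟩
      · obtain ⟨l, hl⟩ := hy.exists_tendsto_right hρ0 ⟨ht.1, h⟩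
        exact ⟨l, hl.mono_left (nhdsWithin_mono _ Ioc_subset_Ioi_self)⟩
    refine ⟨{s | y s ∈ Metric.ball (y t) ε ∪ Metric.ball l ε}, ?_, {y t, l}, Set.toFinite _, ?_⟩
    · rw [← Icc_union_Ioc_eq_Icc ht.1 ht.2, nhdsWithin_union]
      refine mem_sup.2 ⟨?_, ?_⟩
      · filter_upwards [hy.continuousWithinAt_left hρ0 ht (Metric.ball_mem_nhds _ hε)] with s hs
        exact Or.inl hs
      · filter_upwards [hl (Metric.ball_mem_nhds _ hε)] with s hs
        exact Or.inr hs
    · rintro _ ⟨s, hs, rfl⟩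
      simpa using hs

/-- Cutting off a piecewise continuous function at a time `a ≥ 0` and continuing it by a continuous
function that has a right limit at `a`; a jump at `a` is allowed only at a knot. -/
theorem ite_le (hρ : ∀ i ≤ q, ρ i < ρ (i + 1)) {w V : ℝ → E}
    (hw : IsPC τ ρ q w) {a : ℝ} (ha : 0 ≤ a) (hV : ContinuousOn V (Ioi a)) {l : E}
    (hl : Tendsto V (𝓝[>] a) (𝓝 l)) (hjump : l = w a ∨ ∃ j ≤ q, a = ρ j) :
    IsPC τ ρ q fun t => if t ≤ a then w t else V t := by
  have hlt : ∀ {t}, t < a → (fun t => if t ≤ a then w t else V t) =ᶠ[𝓝 t] w := fun {t} h => by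
    filter_upwards [Iio_mem_nhds h] with s hs
    exact if_pos (le_of_lt hs)
  have hgt : ∀ {t}, a < t → (fun t => if t ≤ a then w t else V t) =ᶠ[𝓝 t] V := fun {t} h => by
    filter_upwards [Ioi_mem_nhds h] with s hs
    exact if_neg (not_le.2 hs)
  have hright : (fun t => if t ≤ a then w t else V t) =ᶠ[𝓝[>] a] V := by
    filter_upwards [self_mem_nhdsWithin] with s hs
    exact if_neg (not_le.2 hs)
  refine ⟨?_, fun i hi t ht => ?_, fun i hi => ?_⟩
  · have : (fun θ : Icc (-τ) 0 => if (θ : ℝ) ≤ a then w θ else V θ) =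
        fun θ : Icc (-τ) 0 => w θ := funext fun θ => if_pos (θ.2.2.trans ha)
    rw [this]
    exact hw.1
  · rcases lt_trichotomy t a with h | rfl | h
    · exact (hw.2.1 i hi t ht).congr_of_eventuallyEq ((hlt h).filter_mono nhdsWithin_le_nhds)
        (hlt h).self_of_nhds
    · have hsplit : Ioc (ρ i) (ρ (i + 1)) ⊆ Ioc (ρ i) t ∪ Ioc t (ρ (i + 1)) := fun s hs => by
        rcases le_or_gt s t with h | h
        · exact Or.inl ⟨hs.1, h⟩
        · exact Or.inr ⟨h, hs.2⟩
      refine ContinuousWithinAt.mono (ContinuousWithinAt.union ?_ ?_) hsplit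
      · refine ((hw.2.1 i hi t ht).mono (Ioc_subset_Ioc_right ht.2)).congr (fun s hs => ?_) ?_
        · exact if_pos hs.2
        · exact if_pos le_rfl
      · rcases hjump with h | ⟨j, hj, h⟩
        · refine ContinuousWithinAt.mono (t := Ioi t) ?_ Ioc_subset_Ioi_self
          rw [ContinuousWithinAt, if_pos le_rfl, ← h]
          exact hl.congr' hright.symm
        · have hij : i < j := by
            by_contra hc
            have := knots_le hρ (not_lt.1 hc) (by omega)
            linarith [ht.1]
          have := knots_le hρ (show i + 1 ≤ j by omega) (by omega)
          have : t = ρ (i + 1) := le_antisymm ht.2 (by rw [h]; exact this)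
          rw [← this, Ioc_self, ContinuousWithinAt, nhdsWithin_empty]
          exact tendsto_bot
    · exact ((hV.continuousAt (Ioi_mem_nhds h)).congr (hgt h).symm).continuousWithinAt
  · rcases lt_trichotomy (ρ i) a with h | h | h
    · obtain ⟨r, hr⟩ := hw.2.2 i hi
      exact ⟨r, hr.congr' ((hlt h).filter_mono nhdsWithin_le_nhds).symm⟩
    · rw [h]
      exact ⟨l, hl.congr' hright.symm⟩
    · refine ⟨V (ρ i), ?_⟩
      exact ((hV.continuousAt (Ioi_mem_nhds h)).tendsto.congr' (hgt h).symm).mono_left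
        nhdsWithin_le_nhds

theorem of_history (hρ0 : ρ 0 = 0) (hρ : ∀ i ≤ q, ρ i < ρ (i + 1)) {χ : ℝ → E}
    (hχ : IsPCHistory τ fun θ => χ θ) : IsPC τ ρ q (extendConst χ) := by
  have hpos : ∀ i ≤ q, 0 ≤ ρ i := fun i hi => by
    rw [← hρ0]
    exact knots_le hρ (Nat.zero_le i) (by omega)
  have heq : ∀ t, 0 < t → extendConst χ t = χ 0 := fun t ht => if_neg (not_le.2 ht)
  refine ⟨?_, fun i hi => ?_, fun i hi => ⟨χ 0, ?_⟩⟩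
  · have : (fun θ : Icc (-τ) 0 => extendConst χ θ) =
        fun θ : Icc (-τ) 0 => χ θ := funext fun θ => if_pos θ.2.2
    rw [this]
    exact hχ
  · exact continuousOn_const.congr fun t ht => heq t ((hpos i hi).trans_lt ht.1)
  · refine tendsto_const_nhds.congr' ?_
    filter_upwards [self_mem_nhdsWithin] with t ht
    exact (heq t ((hpos i hi).trans_lt ht)).symm

theorem norm_le_pcNorm (hρ0 : ρ 0 = 0) {y : ℝ → E} (hy : IsPC τ ρ q y) {t : ℝ}
    (ht : t ∈ Icc (-τ) (ρ (q + 1))) : ‖y t‖ ≤ pcNorm τ (ρ (q + 1)) y := by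
  obtain ⟨C, hC⟩ := (hy.totallyBounded_image hρ0).isBounded.exists_norm_le
  refine le_ciSup (f := fun t : Icc (-τ) (ρ (q + 1)) => ‖y t‖) ⟨C, ?_⟩ ⟨t, ht⟩
  rintro _ ⟨s, rfl⟩
  exact hC _ ⟨s, s.2, rfl⟩

end IsPC

theorem supNorm_le {ι E : Type*} [NormedAddCommGroup E] {x : ι → E} {C : ℝ} (hC : 0 ≤ C)
    (h : ∀ i, ‖x i‖ ≤ C) : supNorm x ≤ C :=
  Real.iSup_le h hC

theorem supNorm_nonneg {ι E : Type*} [NormedAddCommGroup E] (x : ι → E) : 0 ≤ supNorm x :=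
  Real.iSup_nonneg fun _ => norm_nonneg _

/-! ### The integral equations in the phase space -/

/-- A forcing term `G s y` that depends only on the values of `y` on `[-τ, s]`, and that is bounded
by `B` and `L`-Lipschitz along functions staying in the tube of radius `R` around `χbar`. -/
structure IsTubeForcing {E H : Type*} [NormedAddCommGroup E] [NormedAddCommGroup H] (τ : ℝ)
    (ρ : ℕ → ℝ) (q : ℕ) (χbar : ℝ → E) (G : ℝ → (ℝ → E) → H) (R L B : ℝ) : Prop where
  congr : ∀ s ∈ Icc 0 (ρ (q + 1)), ∀ y z, EqOn y z (Icc (-τ) s) → G s y = G s z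
  norm_le : ∀ s ∈ Icc 0 (ρ (q + 1)), ∀ y, IsPC τ ρ q y →
    (∀ t ∈ Icc (-τ) s, ‖y t - χbar t‖ ≤ R) → ‖G s y‖ ≤ B
  sub_le : ∀ s ∈ Icc 0 (ρ (q + 1)), ∀ y z, IsPC τ ρ q y → IsPC τ ρ q z →
    (∀ t ∈ Icc (-τ) s, ‖y t - χbar t‖ ≤ R) → (∀ t ∈ Icc (-τ) s, ‖z t - χbar t‖ ≤ R) →
    ∀ e, 0 ≤ e → (∀ t ∈ Icc (-τ) s, ‖y t - z t‖ ≤ e) → ‖G s y - G s z‖ ≤ L * e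
  measurable : ∀ y, IsPC τ ρ q y →
    AEStronglyMeasurable (fun s => G s y) (volume.restrict (Icc 0 (ρ (q + 1))))

/-- The operators `P` by which the arguments of the forcing and of the impulses may be
precomposed: contractions for which `P U(t) - 1` is a contraction too. Both the identity and the
spectral projections are of this kind. -/
structure IsAdmissible {E : Type*} [NormedAddCommGroup E] [NormedSpace ℝ E] (U : ℝ → E → E)
    (P : E →L[ℝ] E) : Prop where
  norm_le : ∀ x, ‖P x‖ ≤ ‖x‖
  semigroup_sub_le : ∀ t, 0 ≤ t → ∀ x, ‖P (U t x) - x‖ ≤ ‖x‖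

/-- The data of the impulsive problem in the phase space `E`, where the constants are such that the
integral operator maps the tube of radius `R` around the constant extension of `χ` into itself and
is a contraction there. -/
structure IsTubeProblem {E H : Type*} [NormedAddCommGroup E] [NormedSpace ℝ E]
    [NormedAddCommGroup H] (U : ℝ → E → E) (K : ℝ → H → E) (α Mα τ : ℝ) (ρ ς : ℕ → ℝ) (q : ℕ)
    (χ : ℝ → E) (G : ℝ → (ℝ → E) → H) (h : ℕ → ℝ → E → E) (R L B c Mh : ℝ) (Lh : ℕ → ℝ) :
    Prop where
  kernel : IsParabolicKernel U K α Mα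
  exponent_nonneg : 0 ≤ α
  const_pos : 0 < Mα
  delay_nonneg : 0 ≤ τ
  knot_zero : ρ 0 = 0
  junction_zero : ς 0 = 0
  junction_lt : ∀ i ≤ q, ς i < ρ (i + 1)
  knot_lt : ∀ i ∈ Icc 1 q, ρ i < ς i
  history : IsPCHistory τ fun θ => χ θ
  history_le : ∀ t ∈ Icc (-τ) 0, ‖χ t‖ ≤ c
  forcing : IsTubeForcing τ ρ q (extendConst χ) G R L B
  bound_pos : 0 < B
  lipschitz_nonneg : 0 ≤ L
  tube : Mh + c + Mα * B * (ρ (q + 1) ^ (1 - α) / (1 - α)) ≤ R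
  contraction : Mα * L * (ρ (q + 1) ^ (1 - α) / (1 - α)) < 1
  impulse_nonneg : 0 ≤ Mh
  impulse_bound : ∀ i ∈ Icc 1 q, ∀ t ∈ Ioc (ρ i) (ς i), ∀ x, ‖h i t x‖ ≤ Mh
  impulse_lip_nonneg : ∀ i ∈ Icc 1 q, 0 ≤ Lh i
  impulse_lip : ∀ i ∈ Icc 1 q, ∀ s ∈ Ioc (ρ i) (ς i), ∀ t ∈ Ioc (ρ i) (ς i), ∀ x y,
    ‖x - χ 0‖ ≤ R → ‖y - χ 0‖ ≤ R → ‖h i s x - h i t y‖ ≤ Lh i * (|s - t| + ‖x - y‖)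

/-- The right hand side of the integral equation on an interval beginning at `a`, with value `v`
at `a`. -/
noncomputable def mildMap {E H : Type*} [NormedAddCommGroup E] [NormedSpace ℝ E]
    (U : ℝ → E → E) (K : ℝ → H → E) (G : ℝ → (ℝ → E) → H) (P : E →L[ℝ] E) (a : ℝ) (v : E)
    (y : ℝ → E) (t : ℝ) : E :=
  U (t - a) v + ∫ s in a..t, K (t - s) (G s fun r => P (y r))

theorem extendConst_of_nonneg {E : Type*} (χ : ℝ → E) {t : ℝ} (ht : 0 ≤ t) :
    extendConst χ t = χ 0 := by
  rcases ht.eq_or_lt with rfl | ht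
  · exact if_pos le_rfl
  · exact if_neg (not_le.2 ht)

namespace IsTubeProblem

variable {E H : Type*} [NormedAddCommGroup E] [NormedSpace ℝ E]
  [NormedAddCommGroup H] {U : ℝ → E → E} {K : ℝ → H → E} {α Mα τ : ℝ} {ρ ς : ℕ → ℝ} {q : ℕ}
  {χ : ℝ → E} {G : ℝ → (ℝ → E) → H} {h : ℕ → ℝ → E → E} {R L B c Mh : ℝ} {Lh : ℕ → ℝ}
  {P : E →L[ℝ] E}

section

variable (D : IsTubeProblem U K α Mα τ ρ ς q χ G h R L B c Mh Lh)
include D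

theorem knot_lt_succ : ∀ i ≤ q, ρ i < ρ (i + 1) := by
  intro i hi
  rcases Nat.eq_zero_or_pos i with rfl | h0
  · have := D.junction_lt 0 hi
    rwa [D.junction_zero, ← D.knot_zero] at this
  · exact (D.knot_lt i ⟨h0, hi⟩).trans (D.junction_lt i hi)

theorem knot_nonneg {i : ℕ} (hi : i ≤ q + 1) : 0 ≤ ρ i := by
  rw [← D.knot_zero]
  exact knots_le D.knot_lt_succ (Nat.zero_le i) hi

theorem knot_le_junction {i : ℕ} (hi : i ≤ q) : ρ i ≤ ς i := by
  rcases Nat.eq_zero_or_pos i with rfl | h0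
  · rw [D.knot_zero, D.junction_zero]
  · exact (D.knot_lt i ⟨h0, hi⟩).le

theorem junction_nonneg {i : ℕ} (hi : i ≤ q) : 0 ≤ ς i :=
  (D.knot_nonneg (by omega)).trans (D.knot_le_junction hi)

theorem knot_le_last {i : ℕ} (hi : i ≤ q + 1) : ρ i ≤ ρ (q + 1) :=
  knots_le D.knot_lt_succ hi le_rfl

theorem one_sub_pos : 0 < 1 - α := sub_pos.2 D.kernel.exponent_lt

theorem rpow_div_le {a t : ℝ} (ha : 0 ≤ a) (hat : a ≤ t) (ht : t ≤ ρ (q + 1)) :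
    (t - a) ^ (1 - α) / (1 - α) ≤ ρ (q + 1) ^ (1 - α) / (1 - α) :=
  div_le_div_of_nonneg_right
    (Real.rpow_le_rpow (by linarith) (by linarith) D.one_sub_pos.le) D.one_sub_pos.le

theorem rpow_div_lt {a t : ℝ} (ha : 0 ≤ a) (hat : a ≤ t) (ht : t < ρ (q + 1)) :
    (t - a) ^ (1 - α) / (1 - α) < ρ (q + 1) ^ (1 - α) / (1 - α) :=
  div_lt_div_of_pos_right
    (Real.rpow_lt_rpow (by linarith) (by linarith) D.one_sub_pos) D.one_sub_pos

theorem radius_ge : Mh + c ≤ R := by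
  have h1 : 0 ≤ ρ (q + 1) ^ (1 - α) / (1 - α) :=
    div_nonneg (Real.rpow_nonneg (D.knot_nonneg le_rfl) _) D.one_sub_pos.le
  have := mul_nonneg (mul_nonneg D.const_pos.le D.bound_pos.le) h1
  linarith [D.tube]

theorem measurable_forcing {y : ℝ → E} (hy : IsPC τ ρ q y) {a b : ℝ} (ha : 0 ≤ a)
    (hb : b ≤ ρ (q + 1)) :
    AEStronglyMeasurable (fun s => G s fun r => P (y r)) (volume.restrict (Ioc a b)) :=
  (D.forcing.measurable _ (hy.comp_clm P)).mono_measure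
    (Measure.restrict_mono
      (show Ioc a b ⊆ Icc 0 (ρ (q + 1)) from fun _ hs => ⟨ha.trans hs.1.le, hs.2.trans hb⟩) le_rfl)

/-- As long as `P ∘ y` has remained in the tube, `P` applied to the integral operator stays at a
distance from `χ 0` that grows with the elapsed time. -/
theorem norm_mildMap_le {y : ℝ → E} (hP : IsAdmissible U P) (hy : IsPC τ ρ q y) {a t : ℝ}
    (ha : 0 ≤ a) (hat : a ≤ t) (ht : t ≤ ρ (q + 1)) {v : E}
    (hv : ∀ r, 0 ≤ r → ‖P (U r v) - χ 0‖ ≤ Mh + c)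
    (hball : ∀ s < t, s ∈ Icc (-τ) t → ‖P (y s) - extendConst χ s‖ ≤ R) :
    ‖P (mildMap U K G P a v y t) - χ 0‖ ≤
      Mh + c + Mα * B * ((t - a) ^ (1 - α) / (1 - α)) := by
  have hB : ∀ s ∈ Ioo a t, ‖G s fun r => P (y r)‖ ≤ B := fun s hs =>
    D.forcing.norm_le s ⟨ha.trans hs.1.le, hs.2.le.trans ht⟩ _ (hy.comp_clm P) fun r hr =>
      hball r (hr.2.trans_lt hs.2) ⟨hr.1, hr.2.trans hs.2.le⟩
  have h1 := D.kernel.norm_conv_le hat hB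
  have h2 := hv (t - a) (sub_nonneg.2 hat)
  have h3 := hP.norm_le (∫ s in a..t, K (t - s) (G s fun r => P (y r)))
  rw [mildMap, map_add, add_sub_right_comm]
  exact (norm_add_le _ _).trans (by linarith)

theorem continuousOn_mildMap {y : ℝ → E} (hy : IsPC τ ρ q y) {a b : ℝ}
    (ha : 0 ≤ a) (hb : b ≤ ρ (q + 1)) (v : E)
    (hball : ∀ s ∈ Icc (-τ) b, ‖P (y s) - extendConst χ s‖ ≤ R) :
    ContinuousOn (mildMap U K G P a v y) (Icc a b) := by
  refine ContinuousOn.add ?_ ?_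
  · exact (D.kernel.U_continuousOn v).comp (by fun_prop) fun t ht => sub_nonneg.2 ht.1
  · refine D.kernel.continuousOn_conv D.exponent_nonneg (C := B) (D.measurable_forcing hy ha hb) ?_
    exact fun s hs => D.forcing.norm_le s ⟨ha.trans hs.1, hs.2.trans hb⟩ _ (hy.comp_clm P)
      fun r hr => hball r ⟨hr.1, hr.2.trans hs.2⟩

theorem norm_mildMap_sub_le {P₁ P₂ : E →L[ℝ] E} {y z : ℝ → E}
    (hy : IsPC τ ρ q y) (hz : IsPC τ ρ q z) {a t : ℝ}
    (ha : 0 ≤ a) (hat : a ≤ t) (ht : t ≤ ρ (q + 1)) (v v' : E)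
    (hby : ∀ s ∈ Icc (-τ) t, ‖P₁ (y s) - extendConst χ s‖ ≤ R)
    (hbz : ∀ s ∈ Icc (-τ) t, ‖P₂ (z s) - extendConst χ s‖ ≤ R) {e : ℝ} (he0 : 0 ≤ e)
    (he : ∀ s ∈ Icc (-τ) t, ‖P₁ (y s) - P₂ (z s)‖ ≤ e) :
    ‖mildMap U K G P₁ a v y t - mildMap U K G P₂ a v' z t‖ ≤
      ‖v - v'‖ + Mα * L * (ρ (q + 1) ^ (1 - α) / (1 - α)) * e := by
  have hmem : ∀ s ∈ Ioo a t, s ∈ Icc 0 (ρ (q + 1)) := fun s hs =>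
    ⟨ha.trans hs.1.le, hs.2.le.trans ht⟩
  have hr : ∀ s ∈ Ioo a t, ∀ r ∈ Icc (-τ) s, r ∈ Icc (-τ) t := fun s hs r hr =>
    ⟨hr.1, hr.2.trans hs.2.le⟩
  have h1 := D.kernel.norm_conv_sub_conv_le hat (D.measurable_forcing (P := P₁) hy ha ht)
    (D.measurable_forcing (P := P₂) hz ha ht) (C := B) (D := L * e)
    (fun s hs => D.forcing.norm_le s (hmem s hs) _ (hy.comp_clm P₁) fun r h => hby r (hr s hs r h))
    (fun s hs => D.forcing.norm_le s (hmem s hs) _ (hz.comp_clm P₂) fun r h => hbz r (hr s hs r h))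
    (fun s hs => D.forcing.sub_le s (hmem s hs) _ _ (hy.comp_clm P₁) (hz.comp_clm P₂)
      (fun r h => hby r (hr s hs r h)) (fun r h => hbz r (hr s hs r h)) e he0
      fun r h => he r (hr s hs r h))
  have h2 : ‖U (t - a) v - U (t - a) v'‖ ≤ ‖v - v'‖ := by
    rw [← D.kernel.U_sub _ (sub_nonneg.2 hat)]
    exact D.kernel.U_norm_le _ (sub_nonneg.2 hat) _
  have h3 : Mα * (L * e) * ((t - a) ^ (1 - α) / (1 - α)) ≤
      Mα * (L * e) * (ρ (q + 1) ^ (1 - α) / (1 - α)) :=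
    mul_le_mul_of_nonneg_left (D.rpow_div_le ha hat ht)
      (mul_nonneg D.const_pos.le (mul_nonneg D.lipschitz_nonneg he0))
  rw [mildMap, mildMap, add_sub_add_comm]
  refine (norm_add_le _ _).trans (add_le_add h2 (h1.trans (h3.trans (le_of_eq ?_))))
  ring

/-- Solving the integral equation on `[a, b]` with given values up to time `a`, by the contraction
principle in the space of continuous functions on `[a, b]` with values in the tube. -/
theorem exists_extension [CompleteSpace E] (hP : IsAdmissible U P) {w : ℝ → E}
    (hw : IsPC τ ρ q w) {a b : ℝ}
    (ha : 0 ≤ a) (hab : a < b) (hb : b ≤ ρ (q + 1))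
    (hv : ∀ r, 0 ≤ r → ‖P (U r (w a)) - χ 0‖ ≤ Mh + c)
    (hball : ∀ t ∈ Icc (-τ) a, ‖P (w t) - extendConst χ t‖ ≤ R) :
    ∃ y, IsPC τ ρ q y ∧ EqOn y w (Iic a) ∧
      (∀ t ∈ Icc (-τ) b, ‖P (y t) - extendConst χ t‖ ≤ R) ∧
      ∀ t ∈ Icc a b, y t = mildMap U K G P a (w a) y t := by
  set A : Icc a b := ⟨a, le_rfl, hab.le⟩ with hA
  let X : Set C(Icc a b, E) := {u | u A = w a ∧ ∀ t, ‖P (u t) - χ 0‖ ≤ R}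
  have hXclosed : IsClosed X := by
    have hset : {u : C(Icc a b, E) | ∀ t, ‖P (u t) - χ 0‖ ≤ R} =
        ⋂ t, {u : C(Icc a b, E) | ‖P (u t) - χ 0‖ ≤ R} := by
      ext u
      simp
    refine IsClosed.inter (isClosed_eq (by fun_prop) continuous_const)
      (s₂ := {u : C(Icc a b, E) | ∀ t, ‖P (u t) - χ 0‖ ≤ R}) ?_
    rw [hset]
    exact isClosed_iInter fun t => isClosed_le (by fun_prop) continuous_const
  let ext : C(Icc a b, E) → ℝ → E := fun u t => if t ≤ a then w t else u (projIcc a b hab.le t)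
  have ext_le : ∀ u, ∀ t ≤ a, ext u t = w t := fun u t ht => if_pos ht
  have ext_mem : ∀ u ∈ X, ∀ t (ht : t ∈ Icc a b), ext u t = u ⟨t, ht⟩ := by
    intro u hu t ht
    rcases ht.1.eq_or_lt with h | h
    · subst h
      rw [ext_le u _ le_rfl]
      exact hu.1.symm
    · have : ext u t = u (projIcc a b hab.le t) := if_neg (not_le.2 h)
      rw [this, projIcc_of_mem hab.le ht]
  have ext_pc : ∀ u ∈ X, IsPC τ ρ q (ext u) := by
    intro u hu
    have hcont : Continuous fun t => u (projIcc a b hab.le t) :=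
      u.continuous.comp continuous_projIcc
    refine hw.ite_le D.knot_lt_succ ha hcont.continuousOn
      (hcont.continuousAt.tendsto.mono_left nhdsWithin_le_nhds) (Or.inl ?_)
    rw [projIcc_left]
    exact hu.1
  have ext_ball : ∀ u ∈ X, ∀ t ∈ Icc (-τ) b, ‖P (ext u t) - extendConst χ t‖ ≤ R := by
    intro u hu t ht
    rcases le_total t a with h | h
    · rw [ext_le u t h]
      exact hball t ⟨ht.1, h⟩
    · rw [ext_mem u hu t ⟨h, ht.2⟩, extendConst_of_nonneg χ (ha.trans h)]
      exact hu.2 _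
  have Φ_cont : ∀ u ∈ X, ContinuousOn (mildMap U K G P a (w a) (ext u)) (Icc a b) := fun u hu =>
    D.continuousOn_mildMap (ext_pc u hu) ha hb _ (ext_ball u hu)
  let Φ : X → X := fun u => ⟨⟨_, (Φ_cont u u.2).domRestrict⟩, by
    refine ⟨?_, fun t => ?_⟩
    · simp [domRestrict, mildMap, hA, D.kernel.U_zero]
    · have hle := (D.norm_mildMap_le hP (ext_pc u u.2) ha t.2.1 (t.2.2.trans hb) hv
        fun s hs hst => ext_ball u u.2 s ⟨hst.1, hst.2.trans t.2.2⟩)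
      refine hle.trans ((add_le_add le_rfl (mul_le_mul_of_nonneg_left
        (D.rpow_div_le ha t.2.1 (t.2.2.trans hb)) ?_)).trans D.tube)
      exact mul_nonneg D.const_pos.le D.bound_pos.le⟩
  have Φ_apply : ∀ (u : X) (t : Icc a b),
      (Φ u : C(Icc a b, E)) t = mildMap U K G P a (w a) (ext u) t := fun _ _ => rfl
  have hκ : 0 ≤ ρ (q + 1) ^ (1 - α) / (1 - α) :=
    div_nonneg (Real.rpow_nonneg (D.knot_nonneg le_rfl) _) D.one_sub_pos.le
  have hQ0 : 0 ≤ Mα * L * (ρ (q + 1) ^ (1 - α) / (1 - α)) :=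
    mul_nonneg (mul_nonneg D.const_pos.le D.lipschitz_nonneg) hκ
  have hcontr : ContractingWith (NNReal.mk _ hQ0) Φ := by
    refine ⟨by exact_mod_cast D.contraction, LipschitzWith.of_dist_le_mul fun u v => ?_⟩
    rw [Subtype.dist_eq, Subtype.dist_eq, NNReal.coe_mk]
    refine (ContinuousMap.dist_le (mul_nonneg hQ0 dist_nonneg)).2 fun t => ?_
    rw [Φ_apply, Φ_apply, dist_eq_norm]
    have ht := t.2.2.trans hb
    refine (D.norm_mildMap_sub_le (ext_pc u u.2) (ext_pc v v.2) ha t.2.1 ht (w a) (w a)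
      (fun s hs => ext_ball u u.2 s ⟨hs.1, hs.2.trans t.2.2⟩)
      (fun s hs => ext_ball v v.2 s ⟨hs.1, hs.2.trans t.2.2⟩)
      (e := dist (u : C(Icc a b, E)) v) dist_nonneg fun s hs => ?_).trans ?_
    · rcases le_total s a with h | h
      · rw [ext_le _ s h, ext_le _ s h, sub_self, norm_zero]
        exact dist_nonneg
      · rw [← map_sub, ext_mem _ u.2 s ⟨h, hs.2.trans t.2.2⟩,
          ext_mem _ v.2 s ⟨h, hs.2.trans t.2.2⟩]
        refine (hP.norm_le _).trans ?_
        rw [← dist_eq_norm]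
        exact ContinuousMap.dist_apply_le_dist _
    · rw [sub_self, norm_zero, zero_add]
  have : CompleteSpace X := hXclosed.completeSpace_coe
  have : Nonempty X := by
    refine ⟨⟨ContinuousMap.const _ (w a), rfl, fun t => ?_⟩⟩
    have := hv 0 le_rfl
    rw [D.kernel.U_zero] at this
    exact this.trans D.radius_ge
  obtain ⟨u, hu⟩ : ∃ u, Φ u = u := ⟨_, hcontr.fixedPoint_isFixedPt⟩
  refine ⟨ext u, ext_pc u u.2, fun t ht => ext_le u t ht, ext_ball u u.2, fun t ht => ?_⟩
  rw [ext_mem u u.2 t ht, ← Φ_apply u ⟨t, ht⟩, hu]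

/-- A solution of the integral equation cannot leave the tube: at a first exit time `t₀ < b` the
bound on the integral operator would still be strict. The equation is only needed at times up to
which the solution is known to be in the tube. -/
theorem mem_tube (hP : IsAdmissible U P) {y : ℝ → E} (hy : IsPC τ ρ q y) {a b : ℝ}
    (ha : 0 ≤ a) (hb : b ≤ ρ (q + 1)) (hcont : ContinuousOn y (Icc a b))
    (hv : ∀ r, 0 ≤ r → ‖P (U r (y a)) - χ 0‖ ≤ Mh + c)
    (hball : ∀ t ∈ Icc (-τ) a, ‖P (y t) - extendConst χ t‖ ≤ R)
    (heq : ∀ t ∈ Icc a b, (∀ s < t, s ∈ Icc (-τ) t → ‖P (y s) - extendConst χ s‖ ≤ R) →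
      y t = mildMap U K G P a (y a) y t) :
    ∀ t ∈ Icc (-τ) b, ‖P (y t) - extendConst χ t‖ ≤ R := by
  by_contra hcon
  push Not at hcon
  obtain ⟨t₁, ht₁, hR₁⟩ := hcon
  have hat₁ : a < t₁ := by
    by_contra hc
    exact absurd (hball t₁ ⟨ht₁.1, not_lt.1 hc⟩) (not_le.2 hR₁)
  set g : ℝ → ℝ := fun t => ‖P (y t) - χ 0‖ with hg
  have hgc : ContinuousOn g (Icc a b) :=
    ((P.continuous.comp_continuousOn hcont).sub continuousOn_const).norm
  have hext : ∀ t, a ≤ t → ‖P (y t) - extendConst χ t‖ = g t := fun t ht => by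
    rw [extendConst_of_nonneg χ (ha.trans ht)]
  have hcl : IsClosed (Icc a b ∩ g ⁻¹' Ici R) := hgc.preimage_isClosed_of_isClosed isClosed_Icc
    isClosed_Ici
  have hcomp : IsCompact (Icc a b ∩ g ⁻¹' Ici R) :=
    isCompact_Icc.of_isClosed_subset hcl inter_subset_left
  obtain ⟨t₀, ⟨ht₀, hR₀⟩, hmin⟩ := hcomp.exists_isLeast
    ⟨t₁, ⟨hat₁.le, ht₁.2⟩, by rw [mem_preimage, ← hext t₁ hat₁.le]; exact hR₁.le⟩
  have hbefore : ∀ s < t₀, s ∈ Icc (-τ) t₀ → ‖P (y s) - extendConst χ s‖ ≤ R := by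
    intro s hs hst
    rcases le_total s a with h | h
    · exact hball s ⟨hst.1, h⟩
    · rw [hext s h]
      by_contra hc
      exact absurd (hmin ⟨⟨h, hs.le.trans ht₀.2⟩, (not_le.1 hc).le⟩) (not_le.2 hs)
  have hle := D.norm_mildMap_le hP hy ha ht₀.1 (ht₀.2.trans hb) hv hbefore
  rw [← heq t₀ ht₀ hbefore] at hle
  have hMB : 0 < Mα * B := mul_pos D.const_pos D.bound_pos
  have hR₀' : R ≤ ‖P (y t₀) - χ 0‖ := hR₀
  have ht₀₁ : t₀ ≤ t₁ := hmin ⟨⟨hat₁.le, ht₁.2⟩, by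
    rw [mem_preimage, ← hext t₁ hat₁.le]; exact hR₁.le⟩
  rcases (ht₀.2.trans hb).eq_or_lt with hlast | hlt
  · have : t₀ = t₁ := le_antisymm ht₀₁ ((ht₁.2.trans hb).trans hlast.ge)
    have h1 := mul_le_mul_of_nonneg_left (D.rpow_div_le ha ht₀.1 (ht₀.2.trans hb)) hMB.le
    rw [hext t₁ hat₁.le, ← this] at hR₁
    have hR₁' : R < ‖P (y t₀) - χ 0‖ := hR₁
    linarith [D.tube]
  · have h1 := mul_lt_mul_of_pos_left (D.rpow_div_lt ha ht₀.1 hlt) hMB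
    linarith [D.tube]

/-- Stability of the integral equation with respect to the initial values and to `P`. -/
theorem norm_sub_le_of_mild {P₁ P₂ : E →L[ℝ] E} (hP₁ : IsAdmissible U P₁) {y z : ℝ → E}
    (hy : IsPC τ ρ q y) (hz : IsPC τ ρ q z) {a b : ℝ}
    (ha : 0 ≤ a) (hab : a ≤ b) (hb : b ≤ ρ (q + 1))
    (hby : ∀ s ∈ Icc (-τ) b, ‖P₁ (y s) - extendConst χ s‖ ≤ R)
    (hbz : ∀ s ∈ Icc (-τ) b, ‖P₂ (z s) - extendConst χ s‖ ≤ R)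
    (hey : ∀ t ∈ Icc a b, y t = mildMap U K G P₁ a (y a) y t)
    (hez : ∀ t ∈ Icc a b, z t = mildMap U K G P₂ a (z a) z t) {e δ : ℝ} (hδ0 : 0 ≤ δ)
    (he : ∀ t ∈ Icc (-τ) a, ‖y t - z t‖ ≤ e)
    (hδ : ∀ t ∈ Icc (-τ) (ρ (q + 1)), ‖P₁ (z t) - P₂ (z t)‖ ≤ δ) :
    ∀ t ∈ Icc (-τ) b, ‖y t - z t‖ ≤
      (e + δ) / (1 - Mα * L * (ρ (q + 1) ^ (1 - α) / (1 - α))) := by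
  set Q := Mα * L * (ρ (q + 1) ^ (1 - α) / (1 - α)) with hQ
  have hκ : 0 ≤ ρ (q + 1) ^ (1 - α) / (1 - α) :=
    div_nonneg (Real.rpow_nonneg (D.knot_nonneg le_rfl) _) D.one_sub_pos.le
  have hQ0 : 0 ≤ Q := mul_nonneg (mul_nonneg D.const_pos.le D.lipschitz_nonneg) hκ
  have hQ1 : Q < 1 := D.contraction
  have hne : ((fun t => ‖y t - z t‖) '' Icc (-τ) b).Nonempty :=
    ⟨_, mem_image_of_mem _ ⟨by linarith [D.delay_nonneg], le_rfl⟩⟩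
  have hbdd : BddAbove ((fun t => ‖y t - z t‖) '' Icc (-τ) b) := by
    refine ⟨pcNorm τ (ρ (q + 1)) y + pcNorm τ (ρ (q + 1)) z, ?_⟩
    rintro _ ⟨t, ht, rfl⟩
    have ht' : t ∈ Icc (-τ) (ρ (q + 1)) := ⟨ht.1, ht.2.trans hb⟩
    exact (norm_sub_le _ _).trans (add_le_add (hy.norm_le_pcNorm D.knot_zero ht')
      (hz.norm_le_pcNorm D.knot_zero ht'))
  set C := sSup ((fun t => ‖y t - z t‖) '' Icc (-τ) b) with hCdef
  have hC : ∀ t ∈ Icc (-τ) b, ‖y t - z t‖ ≤ C := fun t ht => le_csSup hbdd (mem_image_of_mem _ ht)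
  have hC0 : 0 ≤ C := (norm_nonneg _).trans (hC b ⟨by linarith [D.delay_nonneg], le_rfl⟩)
  have ha' : a ∈ Icc (-τ) a := ⟨by linarith [D.delay_nonneg], le_rfl⟩
  have hCle : C ≤ e + Q * (C + δ) := by
    refine csSup_le hne ?_
    rintro _ ⟨t, ht, rfl⟩
    have hCδ : 0 ≤ C + δ := add_nonneg hC0 hδ0
    rcases le_total t a with h | h
    · exact (he t ⟨ht.1, h⟩).trans (le_add_of_nonneg_right (mul_nonneg hQ0 hCδ))
    · simp only
      rw [hey t ⟨h, ht.2⟩, hez t ⟨h, ht.2⟩]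
      refine (D.norm_mildMap_sub_le hy hz ha h (ht.2.trans hb) (y a) (z a)
        (fun s hs => hby s ⟨hs.1, hs.2.trans ht.2⟩) (fun s hs => hbz s ⟨hs.1, hs.2.trans ht.2⟩)
        hCδ fun s hs => ?_).trans (add_le_add (he a ha') le_rfl)
      have hsplit : P₁ (y s) - P₂ (z s) = P₁ (y s - z s) + (P₁ (z s) - P₂ (z s)) := by
        rw [map_sub]
        abel
      rw [hsplit]
      refine (norm_add_le _ _).trans (add_le_add ((hP₁.norm_le _).trans ?_) ?_)
      · exact hC s ⟨hs.1, hs.2.trans ht.2⟩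
      · exact hδ s ⟨hs.1, hs.2.trans (ht.2.trans hb)⟩
  intro t ht
  refine (hC t ht).trans ?_
  rw [le_div_iff₀ (by linarith)]
  nlinarith

end

end IsTubeProblem

/-! ### Solutions on the whole interval -/

/-- A solution of the impulsive problem on `[-τ, ρ (k + 1)]` in the phase space, with `P`
precomposed to the arguments of the forcing and of the impulses, which stays in the tube. On each
interval the integral equation is written in terms of the value at its left end. -/
structure IsTubeSolution {E H : Type*} [NormedAddCommGroup E] [NormedSpace ℝ E]
    [NormedAddCommGroup H] (U : ℝ → E → E) (K : ℝ → H → E) (τ : ℝ) (ρ ς : ℕ → ℝ) (q : ℕ)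
    (χ : ℝ → E) (G : ℝ → (ℝ → E) → H) (h : ℕ → ℝ → E → E) (R : ℝ) (P : E →L[ℝ] E) (k : ℕ)
    (y : ℝ → E) : Prop where
  isPC : IsPC τ ρ q y
  initial : ∀ t ∈ Icc (-τ) 0, y t = χ t
  tube : ∀ t ∈ Icc (-τ) (ρ (k + 1)), ‖P (y t) - extendConst χ t‖ ≤ R
  mild : ∀ i ≤ k, ∀ t ∈ Icc (ς i) (ρ (i + 1)), y t = mildMap U K G P (ς i) (y (ς i)) y t
  impulse : ∀ i ∈ Icc 1 k, ∀ t ∈ Ioc (ρ i) (ς i), y t = h i t (P (y (ρ i)))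

namespace IsTubeProblem

variable {E H : Type*} [NormedAddCommGroup E] [NormedSpace ℝ E]
  [NormedAddCommGroup H] {U : ℝ → E → E} {K : ℝ → H → E} {α Mα τ : ℝ} {ρ ς : ℕ → ℝ} {q : ℕ}
  {χ : ℝ → E} {G : ℝ → (ℝ → E) → H} {h : ℕ → ℝ → E → E} {R L B c Mh : ℝ} {Lh : ℕ → ℝ}
  {P : E →L[ℝ] E} (D : IsTubeProblem U K α Mα τ ρ ς q χ G h R L B c Mh Lh)

include D

theorem norm_initial_le : ‖χ 0‖ ≤ c :=
  D.history_le 0 ⟨by linarith [D.delay_nonneg], le_rfl⟩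

theorem initial_mem_tube (hP : IsAdmissible U P) {t : ℝ} (ht : t ∈ Icc (-τ) 0) :
    ‖P (χ t) - extendConst χ t‖ ≤ R := by
  have h1 := hP.semigroup_sub_le 0 le_rfl (χ t)
  rw [D.kernel.U_zero] at h1
  have h2 : extendConst χ t = χ t := if_pos ht.2
  rw [h2]
  linarith [D.history_le t ht, D.radius_ge, D.impulse_nonneg]

theorem norm_semigroup_initial_le (hP : IsAdmissible U P) {r : ℝ} (hr : 0 ≤ r) :
    ‖P (U r (χ 0)) - χ 0‖ ≤ Mh + c := by
  linarith [hP.semigroup_sub_le r hr (χ 0), D.norm_initial_le, D.impulse_nonneg]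

theorem norm_semigroup_sub_initial_le (hP : IsAdmissible U P) {v : E} (hv : ‖v‖ ≤ Mh) {r : ℝ}
    (hr : 0 ≤ r) : ‖P (U r v) - χ 0‖ ≤ Mh + c := by
  have h1 := hP.norm_le (U r v)
  have h2 := D.kernel.U_norm_le r hr v
  linarith [norm_sub_le (P (U r v)) (χ 0), D.norm_initial_le]

theorem impulse_mem_tube (hP : IsAdmissible U P) {v : E} (hv : ‖v‖ ≤ Mh) :
    ‖P v - χ 0‖ ≤ R := by
  have := D.norm_semigroup_sub_initial_le hP hv le_rfl
  rw [D.kernel.U_zero] at this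
  exact this.trans D.radius_ge

theorem mildMap_congr {y z : ℝ → E} {a t : ℝ} (ha : 0 ≤ a) (hat : a ≤ t) (ht : t ≤ ρ (q + 1))
    (v : E) (hyz : EqOn y z (Iic t)) : mildMap U K G P a v y t = mildMap U K G P a v z t := by
  rw [mildMap, mildMap]
  congr 1
  refine intervalIntegral.integral_congr fun s hs => ?_
  rw [uIcc_of_le hat] at hs
  rw [D.forcing.congr s ⟨ha.trans hs.1, hs.2.trans ht⟩ _ _
    fun r hr => congrArg P (hyz (hr.2.trans hs.2))]

/-- The impulse, as a function of time, has a right limit at the knot, since it is Lipschitz. -/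
theorem exists_tendsto_impulse [CompleteSpace E] {i : ℕ} (hi : i ∈ Icc 1 q) {x : E}
    (hx : ‖x - χ 0‖ ≤ R) :
    ContinuousOn (fun t => h i t x) (Ioc (ρ i) (ς i)) ∧
      ∃ l, Tendsto (fun t => h i t x) (𝓝[>] (ρ i)) (𝓝 l) := by
  have hlip : LipschitzOnWith (Lh i).toNNReal (fun t => h i t x) (Ioc (ρ i) (ς i)) := by
    refine LipschitzOnWith.of_dist_le_mul fun s hs t ht => ?_
    have := D.impulse_lip i hi s hs t ht x x hx hx
    rw [sub_self, norm_zero, add_zero] at this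
    rw [Real.coe_toNNReal _ (D.impulse_lip_nonneg i hi), dist_eq_norm, Real.dist_eq]
    exact this
  refine ⟨hlip.continuousOn, ?_⟩
  have hlt := D.knot_lt i hi
  have hc : Cauchy (map (fun t => h i t x) (𝓝[Ioc (ρ i) (ς i)] (ρ i))) := by
    have hne : (𝓝[Ioc (ρ i) (ς i)] (ρ i)).NeBot := by
      rw [nhdsWithin_Ioc_eq_nhdsGT hlt]
      infer_instance
    exact ((cauchy_nhds (a := ρ i)).mono' hne inf_le_left).map_of_le
      hlip.uniformContinuousOn inf_le_right
  obtain ⟨l, hl⟩ := CompleteSpace.complete hc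
  rw [nhdsWithin_Ioc_eq_nhdsGT hlt] at hl
  exact ⟨l, hl⟩

theorem exists_isTubeSolution [CompleteSpace E] (hP : IsAdmissible U P) {k : ℕ} (hk : k ≤ q) :
    ∃ y, IsTubeSolution U K τ ρ ς q χ G h R P k y := by
  induction k with
  | zero =>
    have h0 : extendConst χ 0 = χ 0 := extendConst_of_nonneg χ le_rfl
    have hw : ∀ t ∈ Icc (-τ) 0, extendConst χ t = χ t := fun t ht => if_pos ht.2
    obtain ⟨y, hy, hyw, hball, hmild⟩ := D.exists_extension hP
      (IsPC.of_history D.knot_zero D.knot_lt_succ D.history) (a := 0) (b := ρ 1) le_rfl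
      (by rw [← D.junction_zero]; exact D.junction_lt 0 hk) (D.knot_le_last (by omega))
      (fun r hr => by rw [h0]; exact D.norm_semigroup_initial_le hP hr)
      fun t ht => by
        conv in P _ => rw [hw t ht]
        exact D.initial_mem_tube hP ht
    refine ⟨y, hy, fun t ht => by rw [hyw ht.2, hw t ht], hball, fun i hi t ht => ?_, ?_⟩
    · obtain rfl : i = 0 := by omega
      rw [D.junction_zero] at ht ⊢
      rw [hyw (mem_Iic.2 le_rfl)]
      exact hmild t ht
    · intro i hi
      exact absurd (hi.1.trans hi.2) (by omega)
  | succ k ih =>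
    obtain ⟨y, hy⟩ := ih (by omega)
    have hi : k + 1 ∈ Icc 1 q := ⟨by omega, hk⟩
    have hlt := D.knot_lt _ hi
    have hρ0 : 0 ≤ ρ (k + 1) := D.knot_nonneg (by omega)
    have hρmem : ρ (k + 1) ∈ Icc (-τ) (ρ (k + 1)) := ⟨by linarith [D.delay_nonneg], le_rfl⟩
    have hx : ‖P (y (ρ (k + 1))) - χ 0‖ ≤ R := by
      have := hy.tube _ hρmem
      rwa [extendConst_of_nonneg χ hρ0] at this
    obtain ⟨hcont, l, hl⟩ := D.exists_tendsto_impulse hi hx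
    -- the impulse on `(ρ (k + 1), ς (k + 1)]`, continued by a constant
    set V : ℝ → E := fun t => h (k + 1) (min t (ς (k + 1))) (P (y (ρ (k + 1)))) with hV
    have hVcont : ContinuousOn V (Ioi (ρ (k + 1))) :=
      hcont.comp (f := fun t => min t (ς (k + 1))) (by fun_prop)
        fun t ht => ⟨lt_min ht hlt, min_le_right _ _⟩
    have hVlim : Tendsto V (𝓝[>] (ρ (k + 1))) (𝓝 l) := by
      refine hl.congr' ?_
      filter_upwards [mem_nhdsWithin_of_mem_nhds (Iio_mem_nhds hlt)] with t ht
      rw [hV]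
      simp only
      rw [min_eq_left (le_of_lt ht)]
    have hw := hy.isPC.ite_le D.knot_lt_succ hρ0 hVcont hVlim (Or.inr ⟨k + 1, hk, rfl⟩)
    set w : ℝ → E := fun t => if t ≤ ρ (k + 1) then y t else V t with hwdef
    have hw_le : ∀ t ≤ ρ (k + 1), w t = y t := fun t ht => if_pos ht
    have hw_gt : ∀ t ∈ Ioc (ρ (k + 1)) (ς (k + 1)),
        w t = h (k + 1) t (P (y (ρ (k + 1)))) := fun t ht => by
      have : w t = V t := if_neg (not_le.2 ht.1)
      rw [this, hV]
      simp only
      rw [min_eq_left ht.2]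
    have hς := hw_gt (ς (k + 1)) ⟨hlt, le_rfl⟩
    obtain ⟨z, hz, hzw, hball, hmild⟩ := D.exists_extension hP hw (a := ς (k + 1))
      (b := ρ (k + 1 + 1)) (D.junction_nonneg hk) (D.junction_lt _ hk) (D.knot_le_last (by omega))
      (fun r hr => D.norm_semigroup_sub_initial_le hP
        (by rw [hς]; exact D.impulse_bound _ hi _ ⟨hlt, le_rfl⟩ _) hr)
      fun t ht => by
        rcases le_or_gt t (ρ (k + 1)) with h | h
        · rw [hw_le t h]
          exact hy.tube t ⟨ht.1, h⟩
        · rw [hw_gt t ⟨h, ht.2⟩, extendConst_of_nonneg χ (hρ0.trans h.le)]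
          exact D.impulse_mem_tube hP (D.impulse_bound _ hi _ ⟨h, ht.2⟩ _)
    have hzy : EqOn z y (Iic (ρ (k + 1))) := fun t ht =>
      (hzw (mem_Iic.2 (le_trans ht hlt.le))).trans (hw_le t ht)
    refine ⟨z, hz, fun t ht => ?_, hball, fun i hik t ht => ?_, fun i hik t ht => ?_⟩
    · rw [hzy (ht.2.trans hρ0), hy.initial t ht]
    · rcases hik.eq_or_lt with rfl | hlt'
      · rw [hzw (mem_Iic.2 le_rfl)]
        exact hmild t ht
      · have hle : ρ (i + 1) ≤ ρ (k + 1) := knots_le D.knot_lt_succ (by omega) (by omega)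
        have htk : t ≤ ρ (k + 1) := ht.2.trans hle
        rw [hzy htk, hzy (ht.1.trans htk), hy.mild i (by omega) t ht]
        exact D.mildMap_congr (D.junction_nonneg (by omega)) ht.1 (htk.trans
          (D.knot_le_last (by omega))) _ fun s hs => (hzy (le_trans hs htk)).symm
    · rcases hik.2.eq_or_lt with rfl | hlt'
      · rw [hzw (mem_Iic.2 ht.2), hw_gt t ht, hzy (mem_Iic.2 le_rfl)]
      · have hle : ρ (i + 1) ≤ ρ (k + 1) := knots_le D.knot_lt_succ (by omega) (by omega)
        have hςi : ς i ≤ ρ (k + 1) := (D.junction_lt i (by omega)).le.trans hle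
        rw [hzy (ht.2.trans hςi), hzy (ht.1.le.trans (ht.2.trans hςi))]
        exact hy.impulse i ⟨hik.1, by omega⟩ t ht

/-- Two solutions for different `P` differ by at most a constant multiple of the difference that
the two operators make on one of the solutions. -/
theorem exists_norm_sub_le {k : ℕ} (hk : k ≤ q) :
    ∃ C, 0 ≤ C ∧ ∀ (P₁ P₂ : E →L[ℝ] E) (y z : ℝ → E) (δ : ℝ), IsAdmissible U P₁ → 0 ≤ δ →
      IsTubeSolution U K τ ρ ς q χ G h R P₁ k y → IsTubeSolution U K τ ρ ς q χ G h R P₂ k z →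
      (∀ t ∈ Icc (-τ) (ρ (q + 1)), ‖P₁ (z t) - P₂ (z t)‖ ≤ δ) →
      ∀ t ∈ Icc (-τ) (ρ (k + 1)), ‖y t - z t‖ ≤ C * δ := by
  have hQ : 0 < 1 - Mα * L * (ρ (q + 1) ^ (1 - α) / (1 - α)) := sub_pos.2 D.contraction
  set Q := Mα * L * (ρ (q + 1) ^ (1 - α) / (1 - α)) with hQdef
  induction k with
  | zero =>
    refine ⟨1 / (1 - Q), by positivity, fun P₁ P₂ y z δ hP₁ hδ0 hy hz hδ t ht => ?_⟩
    have h0 := D.junction_zero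
    refine (D.norm_sub_le_of_mild hP₁ hy.isPC hz.isPC (a := ς 0) h0.ge
      (D.junction_lt 0 hk).le (D.knot_le_last (by omega)) hy.tube hz.tube (hy.mild 0 le_rfl)
      (hz.mild 0 le_rfl) (e := 0) hδ0 (fun s hs => ?_) hδ t ht).trans (le_of_eq ?_)
    · rw [h0] at hs
      rw [hy.initial s hs, hz.initial s hs, sub_self, norm_zero]
    · rw [zero_add, ← hQdef, one_div_mul_eq_div]
  | succ k ih =>
    obtain ⟨C, hC0, hC⟩ := ih (by omega)
    have hi : k + 1 ∈ Icc 1 q := ⟨by omega, hk⟩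
    have hL := D.impulse_lip_nonneg _ hi
    have hlt := D.knot_lt _ hi
    have hρ0 : 0 ≤ ρ (k + 1) := D.knot_nonneg (by omega)
    have hρmem : ρ (k + 1) ∈ Icc (-τ) (ρ (k + 1)) := ⟨by linarith [D.delay_nonneg], le_rfl⟩
    have hle : ρ (k + 1) ≤ ρ (k + 1 + 1) := (D.knot_lt_succ _ hk).le
    have hρmem' : ρ (k + 1) ∈ Icc (-τ) (ρ (k + 1 + 1)) := ⟨hρmem.1, hle⟩
    refine ⟨(C + Lh (k + 1) * (C + 1) + 1) / (1 - Q), by positivity,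
      fun P₁ P₂ y z δ hP₁ hδ0 hy hz hδ t ht => ?_⟩
    have hyz : ∀ t ∈ Icc (-τ) (ρ (k + 1)), ‖y t - z t‖ ≤ C * δ := by
      refine hC P₁ P₂ y z δ hP₁ hδ0 ?_ ?_ hδ
      · exact ⟨hy.isPC, hy.initial, fun t ht => hy.tube t ⟨ht.1, ht.2.trans hle⟩,
          fun i hi => hy.mild i (by omega), fun i hi => hy.impulse i ⟨hi.1, hi.2.trans (by omega)⟩⟩
      · exact ⟨hz.isPC, hz.initial, fun t ht => hz.tube t ⟨ht.1, ht.2.trans hle⟩,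
          fun i hi => hz.mild i (by omega), fun i hi => hz.impulse i ⟨hi.1, hi.2.trans (by omega)⟩⟩
    have hρq : ρ (k + 1) ∈ Icc (-τ) (ρ (q + 1)) := ⟨hρmem.1, D.knot_le_last (by omega)⟩
    have hPyz : ‖P₁ (y (ρ (k + 1))) - P₂ (z (ρ (k + 1)))‖ ≤ (C + 1) * δ := by
      have hsplit : P₁ (y (ρ (k + 1))) - P₂ (z (ρ (k + 1))) =
          P₁ (y (ρ (k + 1)) - z (ρ (k + 1))) + (P₁ (z (ρ (k + 1))) - P₂ (z (ρ (k + 1)))) := by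
        rw [map_sub]
        abel
      rw [hsplit]
      refine (norm_add_le _ _).trans ?_
      linarith [hP₁.norm_le (y (ρ (k + 1)) - z (ρ (k + 1))), hyz _ hρmem, hδ _ hρq]
    have hbefore : ∀ s ∈ Icc (-τ) (ς (k + 1)),
        ‖y s - z s‖ ≤ (C + Lh (k + 1) * (C + 1)) * δ := by
      intro s hs
      have h1 : 0 ≤ Lh (k + 1) * ((C + 1) * δ) := by positivity
      have h2 : 0 ≤ C * δ := by positivity
      rcases le_or_gt s (ρ (k + 1)) with h | h
      · linarith [hyz s ⟨hs.1, h⟩]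
      · have hs' : s ∈ Ioc (ρ (k + 1)) (ς (k + 1)) := ⟨h, hs.2⟩
        rw [hy.impulse (k + 1) ⟨hi.1, le_rfl⟩ s hs', hz.impulse (k + 1) ⟨hi.1, le_rfl⟩ s hs']
        have hy' := hy.tube _ hρmem'
        have hz' := hz.tube _ hρmem'
        rw [extendConst_of_nonneg χ hρ0] at hy' hz'
        have h3 := D.impulse_lip _ hi s hs' s hs' _ _ hy' hz'
        rw [sub_self, abs_zero, zero_add] at h3
        have h4 := mul_le_mul_of_nonneg_left hPyz hL
        linarith
    refine (D.norm_sub_le_of_mild hP₁ hy.isPC hz.isPC (D.junction_nonneg hk)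
      (D.junction_lt _ hk).le (D.knot_le_last (by omega)) hy.tube hz.tube (hy.mild _ le_rfl)
      (hz.mild _ le_rfl) hδ0 hbefore hδ t ht).trans (le_of_eq ?_)
    rw [← hQdef]
    ring

theorem eqOn_of_isTubeSolution (hP : IsAdmissible U P) {y z : ℝ → E}
    (hy : IsTubeSolution U K τ ρ ς q χ G h R P q y)
    (hz : IsTubeSolution U K τ ρ ς q χ G h R P q z) : EqOn y z (Icc (-τ) (ρ (q + 1))) := by
  obtain ⟨C, -, hC⟩ := D.exists_norm_sub_le (k := q) le_rfl
  intro t ht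
  have := hC P P y z 0 hP le_rfl hy hz (fun s _ => by rw [sub_self, norm_zero]) t ht
  rw [mul_zero, norm_le_zero_iff, sub_eq_zero] at this
  exact this

/-- If `P n → 1` strongly, then the corresponding solutions converge uniformly: on the totally
bounded range of the limit solution, the convergence `P n → 1` is uniform. -/
theorem tendsto_pcNorm_sub {P : ℕ → E →L[ℝ] E} (hP : ∀ n, IsAdmissible U (P n))
    (hlim : ∀ x, Tendsto (fun n => P n x) atTop (𝓝 x)) {y : ℝ → E} {yn : ℕ → ℝ → E}
    (hy : IsTubeSolution U K τ ρ ς q χ G h R (ContinuousLinearMap.id ℝ E) q y)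
    (hyn : ∀ n, IsTubeSolution U K τ ρ ς q χ G h R (P n) q (yn n)) :
    Tendsto (fun n => pcNorm τ (ρ (q + 1)) fun t => yn n t - y t) atTop (𝓝 0) := by
  obtain ⟨C, hC0, hC⟩ := D.exists_norm_sub_le (k := q) le_rfl
  rw [Metric.tendsto_atTop']
  intro ε hε
  set δ := ε / (C + 1) / 2 with hδ
  have hδ0 : 0 < δ := by positivity
  obtain ⟨L, hL, hcover⟩ := Metric.totallyBounded_iff.1 (hy.isPC.totallyBounded_image D.knot_zero)
    (δ / 3) (by positivity)
  have hev : ∀ᶠ n in atTop, ∀ l ∈ L, ‖P n l - l‖ < δ / 3 := by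
    refine (eventually_all_finite hL).2 fun l _ => ?_
    have := ((hlim l).sub_const l).norm
    rw [sub_self, norm_zero] at this
    exact this (gt_mem_nhds (by positivity))
  obtain ⟨N, hN⟩ := eventually_atTop.1 hev
  refine ⟨N, fun n hn => ?_⟩
  have hPy : ∀ t ∈ Icc (-τ) (ρ (q + 1)),
      ‖P n (y t) - ContinuousLinearMap.id ℝ E (y t)‖ ≤ δ := by
    intro t ht
    obtain ⟨l, hl, hyl⟩ := mem_iUnion₂.1 (hcover (mem_image_of_mem y ht))
    rw [Metric.mem_ball, dist_eq_norm] at hyl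
    have h1 := hN n hn.le l hl
    have h2 := (hP n).norm_le (y t - l)
    have hsplit : P n (y t) - ContinuousLinearMap.id ℝ E (y t) =
        P n (y t - l) + (P n l - l) - (y t - l) := by
      rw [map_sub, ContinuousLinearMap.id_apply]
      abel
    rw [hsplit]
    linarith [norm_sub_le (P n (y t - l) + (P n l - l)) (y t - l),
      norm_add_le (P n (y t - l)) (P n l - l)]
  have hle : pcNorm τ (ρ (q + 1)) (fun t => yn n t - y t) ≤ C * δ :=
    supNorm_le (by positivity) fun t =>
      hC (P n) _ (yn n) y δ (hP n) hδ0.le (hyn n) hy hPy t t.2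
  rw [dist_zero_right, pcNorm, Real.norm_of_nonneg (supNorm_nonneg _)]
  refine hle.trans_lt ?_
  have h1 : (C + 1) * δ = ε / 2 := by
    rw [hδ]
    field_simp
  linarith

end IsTubeProblem

/-! ### Mild solutions in `H` and in `D(A ^ α)` -/

open SpectralOperator SpectralOperator.FracSpace

section

variable {𝕜 H : Type*} [RCLike 𝕜] [NormedAddCommGroup H] [InnerProductSpace 𝕜 H] [CompleteSpace H]
  {S : SpectralOperator 𝕜 H} {α : ℝ}

/-- The semigroup as a family of operators from `H` to `H_α`. At time `0` only its values on `H_α`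
are meaningful. -/
noncomputable def smoothing (S : SpectralOperator 𝕜 H) (α : ℝ) (T : ℝ → H →L[𝕜] H) (t : ℝ)
    (x : H) : S.FracSpace α := S.toFrac α (T t x)

/-- The restriction of the semigroup to `H_α`. -/
noncomputable def fracSemigroup (S : SpectralOperator 𝕜 H) (α : ℝ) (T : ℝ → H →L[𝕜] H) (t : ℝ)
    (x : S.FracSpace α) : S.FracSpace α := S.toFrac α (T t (incl x))

theorem norm_toFrac {x : H} (hx : x ∈ (S.fracPow α).domain) :
    ‖S.toFrac α x‖ = ‖S.fracPow α ⟨x, hx⟩‖ := by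
  obtain ⟨z, hz⟩ := S.exists_incl_eq hx
  have : S.toFrac α x = z := by rw [← hz, S.toFrac_incl]
  rw [this]
  subst hz
  rfl

theorem one_le_of_norm_semigroup_le {T : ℝ → H →L[𝕜] H} (hT : IsSemigroupGeneratedByNeg S.A T)
    {M : ℝ} (hM : ∀ t, 0 ≤ t → ‖T t‖ ≤ M) : 1 ≤ M := by
  have h1 := (T 0).le_opNorm (S.ψ 0)
  rw [hT.map_zero, ContinuousLinearMap.id_apply, S.ψ.orthonormal.1 0, mul_one, ← hT.map_zero] at h1
  exact h1.trans (hM 0 le_rfl)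

variable [NormedSpace ℝ H] [IsScalarTower ℝ 𝕜 H] {T : ℝ → H →L[𝕜] H} {M Mα : ℝ}

theorem isParabolicKernel_semigroup (hT : IsSemigroupGeneratedByNeg S.A T)
    (hα : α ∈ Ioo (0 : ℝ) 1) (hM : ∀ t, 0 ≤ t → ‖T t‖ ≤ M) (hMα : 0 < Mα)
    (hTα : ∀ t, 0 < t → ∀ (x : H) (hx : T t x ∈ (S.fracPow α).domain),
      ‖S.fracPow α ⟨T t x, hx⟩‖ ≤ Mα * t ^ (-α) * ‖x‖) :
    IsParabolicKernel (fracSemigroup S α T) (smoothing S α T) α Mα where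
  exponent_lt := hα.2
  const_nonneg := hMα.le
  U_zero x := by
    rw [fracSemigroup, hT.map_zero]
    exact S.toFrac_incl x
  U_sub t ht x y := S.toFrac_semigroup_incl_sub hT hM hα ht x y
  U_norm_le t ht x := S.norm_toFrac_semigroup_incl_le hT hM hα ht x
  U_continuousOn x := S.continuousOn_toFrac_semigroup_incl hT hM hα x
  K_sub t ht x y := S.toFrac_semigroup_sub hT hM hα ht x y
  K_norm_le t ht x := by
    have hx := S.semigroup_mem_fracDomain hT hM hα ht x
    rw [smoothing, norm_toFrac hx]
    exact hTα t ht x hx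
  K_continuousOn x := S.continuousOn_toFrac_semigroup hT hM hα x
  K_measurable hg hg0 hf := S.aestronglyMeasurable_toFrac_semigroup hT hM hα hg hg0 hf

theorem isAdmissible_projL (hT : IsSemigroupGeneratedByNeg S.A T)
    (hα : α ∈ Ioo (0 : ℝ) 1) (hM : ∀ t, 0 ≤ t → ‖T t‖ ≤ M) (n : ℕ) :
    IsAdmissible (fracSemigroup S α T) (S.projL α n) where
  norm_le x := S.norm_proj_le n x
  semigroup_sub_le _ ht x := S.norm_proj_semigroup_sub_le hT hM hα ht n x

theorem isAdmissible_id (hT : IsSemigroupGeneratedByNeg S.A T)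
    (hα : α ∈ Ioo (0 : ℝ) 1) (hM : ∀ t, 0 ≤ t → ‖T t‖ ≤ M) :
    IsAdmissible (fracSemigroup S α T) (ContinuousLinearMap.id ℝ (S.FracSpace α)) where
  norm_le _ := le_rfl
  semigroup_sub_le _ ht x := S.norm_semigroup_sub_le hT hM hα ht x

/-- The convolution in `H_α` is mapped to the convolution in `H` by the inclusion. -/
theorem incl_conv (hT : IsSemigroupGeneratedByNeg S.A T)
    (hα : α ∈ Ioo (0 : ℝ) 1) (hM : ∀ t, 0 ≤ t → ‖T t‖ ≤ M)
    (hK : IsParabolicKernel (fracSemigroup S α T) (smoothing S α T) α Mα) {a t C : ℝ}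
    (hat : a ≤ t) {f : ℝ → H} (hf : AEStronglyMeasurable f (volume.restrict (Ioc a t)))
    (hC : ∀ s ∈ Ioo a t, ‖f s‖ ≤ C) :
    IntervalIntegrable (fun s => T (t - s) (f s)) volume a t ∧
      incl (∫ s in a..t, smoothing S α T (t - s) (f s)) = ∫ s in a..t, T (t - s) (f s) := by
  have := S.completeSpace_fracSpace hα.1.le
  have hint := hK.intervalIntegrable_conv hat hf hC
  have hne : ∀ᵐ s : ℝ, s ≠ t := by simp [ae_iff]
  have hae : ∀ᵐ s : ℝ, s ∈ Ioc a t →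
      inclL S hα.1.le (smoothing S α T (t - s) (f s)) = T (t - s) (f s) := by
    filter_upwards [hne] with s hs hst
    exact S.incl_toFrac (S.semigroup_mem_fracDomain hT hM hα
      (sub_pos.2 (lt_of_le_of_ne hst.2 hs)) _)
  constructor
  · rw [intervalIntegrable_iff_integrableOn_Ioc_of_le hat] at hint ⊢
    refine ((inclL S hα.1.le).integrable_comp hint).congr ?_
    rw [EventuallyEq, ae_restrict_iff' measurableSet_Ioc]
    exact hae
  · have h := (inclL S hα.1.le).intervalIntegral_comp_comm hint
    refine Eq.trans h.symm (intervalIntegral.integral_congr_ae ?_)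
    rw [uIoc_of_le hat]
    exact hae

theorem incl_fracSemigroup (hT : IsSemigroupGeneratedByNeg S.A T)
    (hα : α ∈ Ioo (0 : ℝ) 1) (hM : ∀ t, 0 ≤ t → ‖T t‖ ≤ M) {t : ℝ} (ht : 0 ≤ t)
    (x : S.FracSpace α) : incl (fracSemigroup S α T t x) = T t (incl x) :=
  S.incl_toFrac (S.semigroup_incl_mem hT hM hα ht x)

/-- A function that satisfies the integral equation on `[a, b]` in `H` and has a right limit in
`H_α` at `a` is right continuous there. No bound on `f` is available at this point; instead,
`T(b - t)` is applied to the equation, which makes the integrand independent of `t`. -/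
theorem tendsto_of_mild (hT : IsSemigroupGeneratedByNeg S.A T)
    (hα : α ∈ Ioo (0 : ℝ) 1) (hM : ∀ t, 0 ≤ t → ‖T t‖ ≤ M) {a b : ℝ} (hab : a < b) {f : ℝ → H}
    {z : ℝ → S.FracSpace α}
    (hz : ∀ t ∈ Icc a b, IntervalIntegrable (fun s => T (t - s) (f s)) volume a t ∧
      incl (z t) = T (t - a) (incl (z a)) + ∫ s in a..t, T (t - s) (f s))
    {l : S.FracSpace α} (hl : Tendsto z (𝓝[>] a) (𝓝 l)) : l = z a := by
  have hcomp : ∀ t ∈ Icc a b, ∀ s ∈ Icc a t, ∀ x, T (b - t) (T (t - s) x) = T (b - s) x := by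
    intro t ht s hs x
    have := hT.map_add (b - t) (t - s) (sub_nonneg.2 ht.2) (sub_nonneg.2 hs.2)
    rw [sub_add_sub_cancel] at this
    rw [this, ContinuousLinearMap.comp_apply]
  have heq : ∀ t ∈ Icc a b, T (b - t) (incl (z t)) =
      T (b - a) (incl (z a)) + ∫ s in a..t, T (b - s) (f s) := by
    intro t ht
    rw [(hz t ht).2, map_add, hcomp t ht a ⟨le_rfl, ht.1⟩,
      ← (T (b - t)).intervalIntegral_comp_comm (hz t ht).1]
    congr 1
    refine intervalIntegral.integral_congr fun s hs => ?_
    rw [uIcc_of_le ht.1] at hs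
    exact hcomp t ht s hs _
  have hmem : Icc a b ∈ 𝓝[>] a := mem_of_superset (Ioc_mem_nhdsGT hab) Ioc_subset_Icc_self
  -- the limit of the right hand side
  have hright : Tendsto (fun t => T (b - a) (incl (z a)) + ∫ s in a..t, T (b - s) (f s)) (𝓝[>] a)
      (𝓝 (T (b - a) (incl (z a)))) := by
    have hint := (hz b ⟨hab.le, le_rfl⟩).1
    have h1 : ContinuousOn (fun t => ∫ s in a..t, T (b - s) (f s)) (uIcc a b) :=
      intervalIntegral.continuousOn_primitive_interval
        ((intervalIntegrable_iff' ..).1 hint)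
    have h2 := h1 a left_mem_uIcc
    rw [ContinuousWithinAt, intervalIntegral.integral_same, uIcc_of_le hab.le] at h2
    have h3 := h2.mono_left (nhdsWithin_le_of_mem hmem)
    simpa using h3.const_add (T (b - a) (incl (z a)))
  -- the limit of the left hand side
  have hleft : Tendsto (fun t => T (b - t) (incl (z t))) (𝓝[>] a) (𝓝 (T (b - a) (incl l))) := by
    have h1 : Tendsto (fun t => T (b - t) (incl l)) (𝓝[>] a) (𝓝 (T (b - a) (incl l))) := by
      have h := (hT.continuousOn_apply hM (incl l)).comp (f := fun t : ℝ => b - t) (s := Icc a b)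
        (by fun_prop) (fun t ht => sub_nonneg.2 ht.2) a ⟨le_rfl, hab.le⟩
      exact h.mono_left (nhdsWithin_le_of_mem hmem)
    have h2 : Tendsto (fun t => T (b - t) (incl (z t) - incl l)) (𝓝[>] a) (𝓝 0) := by
      have h3 : Tendsto (fun t => ‖(incl (z t) : H) - incl l‖) (𝓝[>] a) (𝓝 0) :=
        tendsto_iff_norm_sub_tendsto_zero.1
          (((inclL S hα.1.le).continuous.tendsto l).comp hl)
      refine squeeze_zero_norm' ?_ h3
      filter_upwards [hmem] with t ht
      exact S.norm_semigroup_le hT hM (sub_nonneg.2 ht.2) _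
    have h4 := h2.add h1
    rw [zero_add] at h4
    refine h4.congr fun t => ?_
    rw [map_sub, sub_add_cancel]
  have hlim : T (b - a) (incl l) = T (b - a) (incl (z a)) := by
    refine tendsto_nhds_unique (hleft.congr' ?_) hright
    filter_upwards [hmem] with t ht
    exact heq t ht
  exact incl_injective (S.semigroup_injective hT hM (sub_nonneg.2 hab.le) hlim)

variable {τ : ℝ} {ρ ς : ℕ → ℝ} {q : ℕ} {χ : ℝ → S.FracSpace α}
  {F : ℝ → (Icc (-τ) 0 → S.FracSpace α) → H} {h : ℕ → ℝ → S.FracSpace α → S.FracSpace α}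
  {R L B c Mh : ℝ} {Lh : ℕ → ℝ} {P : S.FracSpace α →L[ℝ] S.FracSpace α} {y : ℝ → S.FracSpace α}

omit [NormedSpace ℝ H] [IsScalarTower ℝ 𝕜 H] in
theorem norm_forcing_le (D : IsTubeProblem (fracSemigroup S α T) (smoothing S α T) α Mα τ ρ ς q χ
      (fun s y => F s (hist τ y s)) h R L B c Mh Lh) (hy : IsPC τ ρ q y) {a t : ℝ} (ha : 0 ≤ a)
    (ht : t ≤ ρ (q + 1))
    (hball : ∀ s < t, s ∈ Icc (-τ) t → ‖P (y s) - extendConst χ s‖ ≤ R) :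
    ∀ s ∈ Ioo a t, ‖F s (hist τ (fun r => P (y r)) s)‖ ≤ B := fun s hs =>
  D.forcing.norm_le s ⟨ha.trans hs.1.le, hs.2.le.trans ht⟩ _ (hy.comp_clm P) fun r hr =>
    hball r (hr.2.trans_lt hs.2) ⟨hr.1, hr.2.trans hs.2.le⟩

/-- In the tube, the integral operator in `H_α` is the one in `H`. -/
theorem incl_mildMap (hT : IsSemigroupGeneratedByNeg S.A T)
    (hα : α ∈ Ioo (0 : ℝ) 1) (hM : ∀ t, 0 ≤ t → ‖T t‖ ≤ M)
    (D : IsTubeProblem (fracSemigroup S α T) (smoothing S α T) α Mα τ ρ ς q χ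
      (fun s y => F s (hist τ y s)) h R L B c Mh Lh) (hy : IsPC τ ρ q y) {a t : ℝ} (ha : 0 ≤ a)
    (hat : a ≤ t) (ht : t ≤ ρ (q + 1)) (v : S.FracSpace α)
    (hball : ∀ s < t, s ∈ Icc (-τ) t → ‖P (y s) - extendConst χ s‖ ≤ R) :
    IntervalIntegrable (fun s => T (t - s) (F s fun θ => P (hist τ y s θ))) volume a t ∧
      incl (mildMap (fracSemigroup S α T) (smoothing S α T) (fun s y => F s (hist τ y s)) P a v y t)
        = T (t - a) (incl v) + ∫ s in a..t, T (t - s) (F s fun θ => P (hist τ y s θ)) := by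
  obtain ⟨h1, h2⟩ := incl_conv hT hα hM D.kernel hat (D.measurable_forcing (P := P) hy ha ht)
    (norm_forcing_le D hy ha ht hball)
  refine ⟨h1, ?_⟩
  rw [mildMap, map_add, incl_fracSemigroup hT hα hM (sub_nonneg.2 hat)]
  exact congrArg _ h2

theorem IsTubeSolution.isMildSolution (hT : IsSemigroupGeneratedByNeg S.A T)
    (hα : α ∈ Ioo (0 : ℝ) 1) (hM : ∀ t, 0 ≤ t → ‖T t‖ ≤ M)
    (D : IsTubeProblem (fracSemigroup S α T) (smoothing S α T) α Mα τ ρ ς q χ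
      (fun s y => F s (hist τ y s)) h R L B c Mh Lh)
    (hy : IsTubeSolution (fracSemigroup S α T) (smoothing S α T) τ ρ ς q χ
      (fun s y => F s (hist τ y s)) h R P q y) :
    IsMildSolution S α T τ ρ ς q χ (fun s x => F s fun θ => P (x θ)) (fun i t x => h i t (P x))
      y where
  initial := hy.initial
  first t ht := by
    have hς := D.junction_zero
    have hle : t ≤ ρ (q + 1) := ht.2.trans (D.knot_le_last (by omega))
    obtain ⟨h1, h2⟩ := incl_mildMap (P := P) hT hα hM D hy.isPC le_rfl ht.1 hle (χ 0)
      fun s _ hs => hy.tube s ⟨hs.1, hs.2.trans hle⟩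
    refine ⟨h1, ?_⟩
    have h3 := hy.mild 0 (Nat.zero_le q) t (by rwa [hς])
    rw [hς, hy.initial 0 ⟨by linarith [D.delay_nonneg], le_rfl⟩] at h3
    rw [← h3, sub_zero] at h2
    exact h2
  impulse i hi t ht := hy.impulse i hi t ht
  later i hi t ht := by
    have hle : t ≤ ρ (q + 1) := ht.2.trans (D.knot_le_last (by have := hi.2; omega))
    obtain ⟨h1, h2⟩ := incl_mildMap (P := P) hT hα hM D hy.isPC (D.junction_nonneg hi.2) ht.1.le
      hle (y (ς i)) fun s _ hs => hy.tube s ⟨hs.1, hs.2.trans hle⟩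
    refine ⟨h1, ?_⟩
    rw [← hy.mild i hi.2 t ⟨ht.1.le, ht.2⟩,
      hy.impulse i hi (ς i) ⟨D.knot_lt i hi, le_rfl⟩] at h2
    exact h2

/-- On an interval where the equation in `H` holds, a solution stays in the tube. -/
theorem mem_tube_of_mild (hT : IsSemigroupGeneratedByNeg S.A T)
    (hα : α ∈ Ioo (0 : ℝ) 1) (hM : ∀ t, 0 ≤ t → ‖T t‖ ≤ M)
    (D : IsTubeProblem (fracSemigroup S α T) (smoothing S α T) α Mα τ ρ ς q χ
      (fun s y => F s (hist τ y s)) h R L B c Mh Lh) (hP : IsAdmissible (fracSemigroup S α T) P)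
    (hy : IsPC τ ρ q y) {i : ℕ} (hi : i ≤ q)
    (hmild : ∀ t ∈ Icc (ς i) (ρ (i + 1)),
      IntervalIntegrable (fun s => T (t - s) (F s fun θ => P (hist τ y s θ))) volume (ς i) t ∧
      incl (y t) = T (t - ς i) (incl (y (ς i))) +
        ∫ s in (ς i)..t, T (t - s) (F s fun θ => P (hist τ y s θ)))
    (hv : ∀ r, 0 ≤ r → ‖P (fracSemigroup S α T r (y (ς i))) - χ 0‖ ≤ Mh + c)
    (hball : ∀ t ∈ Icc (-τ) (ς i), ‖P (y t) - extendConst χ t‖ ≤ R) :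
    (∀ t ∈ Icc (-τ) (ρ (i + 1)), ‖P (y t) - extendConst χ t‖ ≤ R) ∧
    ∀ t ∈ Icc (ς i) (ρ (i + 1)), y t = mildMap (fracSemigroup S α T) (smoothing S α T)
      (fun s y => F s (hist τ y s)) P (ς i) (y (ς i)) y t := by
  have hς0 := D.junction_nonneg hi
  have hlt := D.junction_lt i hi
  have hlast : ρ (i + 1) ≤ ρ (q + 1) := D.knot_le_last (by omega)
  have heq : ∀ t ∈ Icc (ς i) (ρ (i + 1)),
      (∀ s < t, s ∈ Icc (-τ) t → ‖P (y s) - extendConst χ s‖ ≤ R) →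
      y t = mildMap (fracSemigroup S α T) (smoothing S α T)
        (fun s y => F s (hist τ y s)) P (ς i) (y (ς i)) y t := by
    intro t ht hb
    apply incl_injective
    rw [(incl_mildMap hT hα hM D hy hς0 ht.1 (ht.2.trans hlast) _ hb).2]
    exact (hmild t ht).2
  have hcont : ContinuousOn y (Icc (ς i) (ρ (i + 1))) := by
    obtain ⟨l, hl⟩ := hy.exists_tendsto_right D.knot_zero (t := ς i)
      ⟨by linarith [D.delay_nonneg], hlt.trans_le hlast⟩
    have hla := tendsto_of_mild hT hα hM hlt hmild hl
    subst hla
    intro t ht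
    rcases ht.1.eq_or_lt with h | h
    · subst h
      have : ContinuousWithinAt y (Ici (ς i)) (ς i) := continuousWithinAt_Ioi_iff_Ici.1 hl
      exact this.mono Icc_subset_Ici_self
    · have h1 := hy.2.1 i hi t ⟨(D.knot_le_junction hi).trans_lt h, ht.2⟩
      refine h1.mono_of_mem_nhdsWithin ?_
      filter_upwards [self_mem_nhdsWithin, mem_nhdsWithin_of_mem_nhds (Ioi_mem_nhds h)]
        with s hs hs'
      exact ⟨(D.knot_le_junction hi).trans_lt hs', hs.2⟩
  have htube := D.mem_tube hP hy hς0 hlast hcont hv hball heq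
  exact ⟨htube, fun t ht => heq t ht fun s _ hs => htube s ⟨hs.1, hs.2.trans ht.2⟩⟩

/-- Every solution of the system in `H` stays in the tube, and hence solves the system in `H_α`. -/
theorem isTubeSolution_of_isMildSolution (hT : IsSemigroupGeneratedByNeg S.A T)
    (hα : α ∈ Ioo (0 : ℝ) 1) (hM : ∀ t, 0 ≤ t → ‖T t‖ ≤ M)
    (D : IsTubeProblem (fracSemigroup S α T) (smoothing S α T) α Mα τ ρ ς q χ
      (fun s y => F s (hist τ y s)) h R L B c Mh Lh) (hP : IsAdmissible (fracSemigroup S α T) P)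
    (hpc : IsPC τ ρ q y)
    (hy : IsMildSolution S α T τ ρ ς q χ (fun s x => F s fun θ => P (x θ))
      (fun i t x => h i t (P x)) y) :
    IsTubeSolution (fracSemigroup S α T) (smoothing S α T) τ ρ ς q χ
      (fun s y => F s (hist τ y s)) h R P q y := by
  have hy0 : y 0 = χ 0 := hy.initial 0 ⟨by linarith [D.delay_nonneg], le_rfl⟩
  have hς := D.junction_zero
  have main : ∀ k ≤ q, (∀ t ∈ Icc (-τ) (ρ (k + 1)), ‖P (y t) - extendConst χ t‖ ≤ R) ∧
      ∀ t ∈ Icc (ς k) (ρ (k + 1)), y t = mildMap (fracSemigroup S α T) (smoothing S α T)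
        (fun s y => F s (hist τ y s)) P (ς k) (y (ς k)) y t := by
    intro k hk
    induction k with
    | zero =>
      refine mem_tube_of_mild hT hα hM D hP hpc hk (fun t ht => ?_) (fun r hr => ?_)
        fun t ht => ?_
      · rw [hς] at ht ⊢
        rw [hy0, sub_zero]
        exact hy.first t ht
      · rw [hς, hy0]
        exact D.norm_semigroup_initial_le hP hr
      · rw [hς] at ht
        rw [hy.initial t ht]
        exact D.initial_mem_tube hP ht
    | succ k ih =>
      have hi : k + 1 ∈ Icc 1 q := ⟨by omega, hk⟩
      have hlt := D.knot_lt _ hi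
      have hv : y (ς (k + 1)) = h (k + 1) (ς (k + 1)) (P (y (ρ (k + 1)))) :=
        hy.impulse _ hi _ ⟨hlt, le_rfl⟩
      refine mem_tube_of_mild hT hα hM D hP hpc hk (fun t ht => ?_) (fun r hr => ?_)
        fun t ht => ?_
      · rcases ht.1.eq_or_lt with h | h
        · subst h
          refine ⟨IntervalIntegrable.refl, ?_⟩
          rw [sub_self, hT.map_zero, intervalIntegral.integral_same, add_zero,
            ContinuousLinearMap.id_apply]
        · rw [hv]
          exact hy.later _ hi t ⟨h, ht.2⟩
      · rw [hv]
        exact D.norm_semigroup_sub_initial_le hP (D.impulse_bound _ hi _ ⟨hlt, le_rfl⟩ _) hr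
      · rcases le_or_gt t (ρ (k + 1)) with h | h
        · exact (ih (by omega)).1 t ⟨ht.1, h⟩
        · rw [hy.impulse _ hi t ⟨h, ht.2⟩,
            extendConst_of_nonneg χ ((D.knot_nonneg (by omega)).trans h.le)]
          exact D.impulse_mem_tube hP (D.impulse_bound _ hi _ ⟨h, ht.2⟩ _)
  exact ⟨hpc, hy.initial, (main q le_rfl).1, fun i hi => (main i hi).2, fun i hi => hy.impulse i hi⟩

end

section

variable {E H : Type*} [NormedAddCommGroup E] [NormedAddCommGroup H]
  {τ : ℝ} {ρ : ℕ → ℝ} {q : ℕ} {χ : ℝ → E} {F : ℝ → (Icc (-τ) 0 → E) → H} {R η LF : ℝ}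

theorem ForcingHyp.isTubeForcing (hF : ForcingHyp τ ρ q (extendConst χ) F R η LF) (hρ0 : ρ 0 = 0)
    (hρ : ∀ i ≤ q, ρ i < ρ (i + 1)) (hχ : IsPCHistory τ fun θ => χ θ) (hη : 0 < η) (hLF : 0 ≤ LF)
    (hR : pcNorm τ (ρ (q + 1)) (extendConst χ) ≤ R) :
    IsTubeForcing τ ρ q (extendConst χ) (fun s y => F s (hist τ y s)) R LF
      (LF * (ρ (q + 1) ^ η + pcNorm τ (ρ (q + 1)) (extendConst χ) + R) + ‖F 0 0‖) := by
  have hχpc := IsPC.of_history hρ0 hρ hχ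
  set c := pcNorm τ (ρ (q + 1)) (extendConst χ) with hc
  have hc0 : 0 ≤ c := supNorm_nonneg _
  have hR0 : 0 ≤ R := hc0.trans hR
  have hT : 0 ≤ ρ (q + 1) := by
    rw [← hρ0]
    exact knots_le hρ (Nat.zero_le _) le_rfl
  have hhist : ∀ s, ∀ θ : Icc (-τ) 0, 0 ≤ s → s + (θ : ℝ) ∈ Icc (-τ) s := fun s θ hs =>
    ⟨by linarith [θ.2.1], by linarith [θ.2.2]⟩
  have hball : ∀ s ∈ Icc 0 (ρ (q + 1)), ∀ y : ℝ → E,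
      (∀ t ∈ Icc (-τ) s, ‖y t - extendConst χ t‖ ≤ R) →
      supNorm (hist τ y s - hist τ (extendConst χ) s) ≤ R := fun s hs y hy =>
    supNorm_le hR0 fun θ => hy _ (hhist s θ hs.1)
  refine ⟨fun s hs y z hyz => ?_, fun s hs y hy hyR => ?_,
    fun s hs y z hy hz hyR hzR e he hyz => ?_,
    hF.measurable⟩
  · have : hist τ y s = hist τ z s := funext fun θ => hyz (hhist s θ hs.1)
    simp only [this]
  · have h0mem : (0 : ℝ) ∈ Icc 0 (ρ (q + 1)) := ⟨le_rfl, hT⟩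
    have hχle : ∀ t ∈ Icc (-τ) s, ‖extendConst χ t‖ ≤ c := fun t ht =>
      hχpc.norm_le_pcNorm hρ0 ⟨ht.1, ht.2.trans hs.2⟩
    have hzero : IsPCHistory τ (0 : Icc (-τ) 0 → E) := by
      refine ⟨fun θ => continuousWithinAt_const, fun θ => ⟨0, tendsto_const_nhds⟩, ?_⟩
      have : {θ | ¬ ContinuousAt (0 : Icc (-τ) 0 → E) θ} = ∅ := by
        ext θ
        simp only [mem_ofPred_eq, mem_empty_iff_false, iff_false, not_not]
        exact continuousAt_const
      rw [this]
      exact Set.finite_empty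
    have hzball : supNorm ((0 : Icc (-τ) 0 → E) - hist τ (extendConst χ) 0) ≤ R := by
      refine (supNorm_le hc0 fun θ => ?_).trans hR
      rw [Pi.sub_apply, Pi.zero_apply, zero_sub, norm_neg]
      have := hhist 0 θ le_rfl
      exact hχpc.norm_le_pcNorm hρ0 ⟨this.1, this.2.trans hT⟩
    have h1 := hF.estimate s hs 0 h0mem _ _ (hy.isPCHistory_hist hρ0 hs) hzero
      (hball s hs y hyR) hzball
    have h2 : supNorm (hist τ y s - 0) ≤ c + R := by
      refine supNorm_le (by positivity) fun θ => ?_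
      have hmem := hhist s θ hs.1
      have h3 := norm_add_le (y (s + θ) - extendConst χ (s + θ)) (extendConst χ (s + θ))
      rw [sub_add_cancel] at h3
      rw [Pi.sub_apply, Pi.zero_apply, sub_zero]
      exact h3.trans (by linarith [hyR _ hmem, hχle _ hmem])
    have h4 : |s - 0| ^ η ≤ ρ (q + 1) ^ η := by
      rw [sub_zero, abs_of_nonneg hs.1]
      exact Real.rpow_le_rpow hs.1 hs.2 hη.le
    have h5 := norm_add_le (F s (hist τ y s) - F 0 0) (F 0 0)
    rw [sub_add_cancel] at h5
    have h6 : LF * (|s - 0| ^ η + supNorm (hist τ y s - 0)) ≤ LF * (ρ (q + 1) ^ η + c + R) :=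
      mul_le_mul_of_nonneg_left (by linarith) hLF
    exact h5.trans (by linarith)
  · have h1 := hF.estimate s hs s hs _ _ (hy.isPCHistory_hist hρ0 hs) (hz.isPCHistory_hist hρ0 hs)
      (hball s hs y hyR) (hball s hs z hzR)
    refine h1.trans (mul_le_mul_of_nonneg_left ?_ hLF)
    have h2 : supNorm (hist τ y s - hist τ z s) ≤ e :=
      supNorm_le he fun θ => hyz _ (hhist s θ hs.1)
    rwa [sub_self, abs_zero, Real.zero_rpow hη.ne', zero_add]

end

/-! ### The radius of the tube -/

theorem le_constR_left {α η M Mα LF Mh c B₁ d : ℝ} {ρ : ℕ → ℝ} {q : ℕ} :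
    constN α η M Mα LF Mh c B₁ d ρ q q / (1 - constQ α Mα LF ρ q) ≤
      constR α η M Mα LF Mh c B₁ d ρ q :=
  le_max_of_le_left (le_ciSup (f := fun i : Fin (q + 1) =>
    constN α η M Mα LF Mh c B₁ d ρ q i / (1 - constQ α Mα LF ρ i)) (Set.finite_range _).bddAbove
    (Fin.last q))

/-- The radius `R` is large enough for the integral operator to preserve the tube on every interval.
The last interval gives the largest of the constants, and as `q ≥ 1`, the first summand in it is
`M M_h + c` rather than `d_0`; the number `d_0` therefore plays no role. -/
theorem tube_le_constR {α η M Mα LF Mh c B₁ d : ℝ} {ρ : ℕ → ℝ} {q : ℕ} (hq : 1 ≤ q)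
    (hM : 1 ≤ M) (hMh : 0 ≤ Mh) (hQ : constQ α Mα LF ρ q < 1) :
    Mh + c + Mα * (LF * (ρ (q + 1) ^ η + c + constR α η M Mα LF Mh c B₁ d ρ q) + B₁) *
      (ρ (q + 1) ^ (1 - α) / (1 - α)) ≤ constR α η M Mα LF Mh c B₁ d ρ q := by
  have h := le_constR_left (α := α) (η := η) (M := M) (Mα := Mα) (LF := LF) (Mh := Mh) (c := c)
    (B₁ := B₁) (d := d) (ρ := ρ) (q := q)
  set R := constR α η M Mα LF Mh c B₁ d ρ q
  rw [div_le_iff₀ (sub_pos.2 hQ), constN, if_neg (by omega), constQ] at h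
  have h1 : Mh ≤ M * Mh := le_mul_of_one_le_left hMh hM
  linarith

end ImpulsiveRetarded

open ImpulsiveRetarded in
theorem theorem4p2 {𝕜 H : Type*} [RCLike 𝕜] [NormedAddCommGroup H] [InnerProductSpace 𝕜 H]
    [CompleteSpace H] [NormedSpace ℝ H] [IsScalarTower ℝ 𝕜 H]
    (S : SpectralOperator 𝕜 H) (T : ℝ → H →L[𝕜] H) (hT : IsSemigroupGeneratedByNeg S.A T)
    -- the exponents and the constants of the semigroup
    (α : ℝ) (hα : α ∈ Ioo (0 : ℝ) 1) (M Mα : ℝ)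
    (hM : ∀ t, 0 ≤ t → ‖T t‖ ≤ M) (hMα : 0 < Mα)
    (hTα : ∀ t, 0 < t → ∀ (x : H) (hx : T t x ∈ (S.fracPow α).domain),
      ‖S.fracPow α ⟨T t x, hx⟩‖ ≤ Mα * t ^ (-α) * ‖x‖)
    -- the times `0 = ς 0 = ρ 0 < ρ 1 < ς 1 < ρ 2 < ... < ς q < ρ (q + 1)`
    (τ : ℝ) (hτ : 0 < τ) (q : ℕ) (hq : 1 ≤ q) (ρ ς : ℕ → ℝ) (hρ0 : ρ 0 = 0) (hς0 : ς 0 = 0)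
    (hςρ : ∀ i ≤ q, ς i < ρ (i + 1)) (hρς : ∀ i ∈ Icc 1 q, ρ i < ς i)
    -- the initial function, with values in `D(A)`
    (χ : ℝ → S.FracSpace α) (hχ : IsPCHistory τ (fun θ => χ θ))
    (hχ_holder : IsLocallyHolder τ (fun t => (χ t : H)))
    (hχ_dom : ∀ t ∈ Icc (-τ) 0, (χ t : H) ∈ S.A.domain)
    -- the forcing and the impulses
    (F : ℝ → (Icc (-τ) 0 → S.FracSpace α) → H) (h : ℕ → ℝ → S.FracSpace α → S.FracSpace α)
    (η LF Mh : ℝ) (Lh : ℕ → ℝ) (hη : η ∈ Ioc (0 : ℝ) 1) (hLF : 0 < LF) (hMh : 0 < Mh)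
    (hLh : ∀ i ∈ Icc 1 q, 0 < Lh i)
    (hQ : ∀ i ≤ q, constQ α Mα LF ρ i < 1)
    (hF : ForcingHyp τ ρ q (extendConst χ) F (radius S α T τ ρ q χ F η M Mα LF Mh) η LF)
    (hh : ImpulseHyp ρ ς q (extendConst χ) h (radius S α T τ ρ q χ F η M Mα LF Mh) Mh Lh) :
    ∃ (y : ℝ → S.FracSpace α) (yn : ℕ → ℝ → S.FracSpace α),
      -- `y` is the unique mild solution of the problem
      (IsPC τ ρ q y ∧ IsMildSolution S α T τ ρ ς q χ F h y ∧
        ∀ z, IsPC τ ρ q z → IsMildSolution S α T τ ρ ς q χ F h z →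
          EqOn z y (Icc (-τ) (ρ (q + 1)))) ∧
      -- `yn n` is the unique solution of the approximate equation
      (∀ n, IsPC τ ρ q (yn n) ∧
        IsMildSolution S α T τ ρ ς q χ (approxF S F n) (approxH S h n) (yn n) ∧
        ∀ z, IsPC τ ρ q z →
          IsMildSolution S α T τ ρ ς q χ (approxF S F n) (approxH S h n) z →
          EqOn z (yn n) (Icc (-τ) (ρ (q + 1)))) ∧
      Tendsto (fun n => pcNorm τ (ρ (q + 1)) (fun t => yn n t - y t)) atTop (𝓝 0) := by
  have hρ : ∀ i ≤ q, ρ i < ρ (i + 1) := by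
    intro i hi
    rcases Nat.eq_zero_or_pos i with rfl | h0
    · rw [hρ0, ← hς0]
      exact hςρ 0 hi
    · exact (hρς i ⟨h0, hi⟩).trans (hςρ i hi)
  have hρnonneg : ∀ i ≤ q + 1, 0 ≤ ρ i := fun i hi => by
    rw [← hρ0]
    exact knots_le hρ (Nat.zero_le i) hi
  have hTpos : 0 < ρ (q + 1) := by
    rw [← hρ0]
    exact knots_lt hρ (Nat.succ_pos q) le_rfl
  have hχpc := IsPC.of_history hρ0 hρ hχ
  set c := pcNorm τ (ρ (q + 1)) (extendConst χ) with hc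
  set R := radius S α T τ ρ q χ F η M Mα LF Mh with hR
  have hc0 : 0 ≤ c := supNorm_nonneg _
  have hcR : Mh + c ≤ R := le_max_right _ _
  have hR0 : 0 ≤ R := by linarith
  have hadm := isAdmissible_projL hT hα hM
  have hid := isAdmissible_id hT hα hM
  have D : IsTubeProblem (fracSemigroup S α T) (smoothing S α T) α Mα τ ρ ς q χ
      (fun s y => F s (hist τ y s)) h R LF (LF * (ρ (q + 1) ^ η + c + R) + ‖F 0 0‖) c Mh Lh :=
    { kernel := isParabolicKernel_semigroup hT hα hM hMα hTα
      exponent_nonneg := hα.1.le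
      const_pos := hMα
      delay_nonneg := hτ.le
      knot_zero := hρ0
      junction_zero := hς0
      junction_lt := hςρ
      knot_lt := hρς
      history := hχ
      history_le := fun t ht => by
        have h1 := hχpc.norm_le_pcNorm hρ0 (t := t) ⟨ht.1, ht.2.trans hTpos.le⟩
        rwa [extendConst, if_pos ht.2] at h1
      forcing := hF.isTubeForcing hρ0 hρ hχ hη.1 hLF.le (by linarith)
      bound_pos := by
        have := Real.rpow_pos_of_pos hTpos η
        positivity
      lipschitz_nonneg := hLF.le
      tube := tube_le_constR hq (one_le_of_norm_semigroup_le hT hM) hMh.le (hQ q le_rfl)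
      contraction := hQ q le_rfl
      impulse_nonneg := hMh.le
      impulse_bound := hh.bound
      impulse_lip_nonneg := fun i hi => (hLh i hi).le
      impulse_lip := fun i hi s hs t ht x y hx hy => by
        have h0 := hρnonneg i (by have := hi.2; omega)
        refine hh.estimate i hi s hs t ht x y ?_ ?_
        · rwa [extendConst_of_nonneg χ (h0.trans hs.1.le)]
        · rwa [extendConst_of_nonneg χ (h0.trans ht.1.le)] }
  have := S.completeSpace_fracSpace hα.1.le
  obtain ⟨y, hy⟩ := D.exists_isTubeSolution hid (k := q) le_rfl
  choose yn hyn using fun n => D.exists_isTubeSolution (hadm n) (k := q) le_rfl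
  refine ⟨y, yn, ⟨hy.isPC, hy.isMildSolution hT hα hM D, fun z hz hzm => ?_⟩,
    fun n => ⟨(hyn n).isPC, (hyn n).isMildSolution hT hα hM D, fun z hz hzm => ?_⟩, ?_⟩
  · exact D.eqOn_of_isTubeSolution hid
      (isTubeSolution_of_isMildSolution hT hα hM D hid hz hzm) hy
  · exact D.eqOn_of_isTubeSolution (hadm n)
      (isTubeSolution_of_isMildSolution hT hα hM D (hadm n) hz hzm) (hyn n)
  · exact D.tendsto_pcNorm_sub hadm (fun x => S.tendsto_proj x) hy hyn
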